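/- Let $s\in\mathbb{N}=\{1,2,\dots\}$, $\alpha\in\mathbb{N}_0=\{0,1,2,\dots\}$ and $0<\lambda\le 1$. **Walsh coefficients.** For $k\in\mathbb{N}_0$ with $k=\sum_{r\ge1}a_r2^{r-1}$, $a_r\in\{0,1\}$, let $\kappa(k)=\{r\ge 1\mid a_r=1\}$, and for $x\in[0,1)$ let $x^{(r)}$ be the $r$-th binary digit of $x$ (from the finite expansion if there are two). Put $\mathrm{wal}_k(x)=\prod_{r\in\kappa(k)}(-1)^{x^{(r)}}$ and, for $\boldsymbol{k}\in\mathbb{N}_0^s$, $\mathrm{wal}_{\boldsymbol{k}}(\boldsymbol{x})=\prod_{j=1}^s\mathrm{wal}_{k_j}(x_j)$ and $\hat f(\boldsymbol{k})=\int_{[0,1]^s}f(\boldsymbol{x})\,\mathrm{wal}_{\boldsymbol{k}}(\boldsymbol{x})\,d\boldsymbol{x}$. Let $\lceil\boldsymbol{k}\rceil_q\in\mathbb{N}_0^s$ be the vector whose $j$-th entry is the $q$-th largest element of $\kappa(k_j)$, or $0$ if $q>|\kappa(k_j)|$. **Fractional variation.** For a box $J=\prod_{j=1}^d[a_j,b_j)$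 let $\Delta(g,J)=\sum_{v\subseteq\{1,\dots,d\}}(-1)^{d-|v|}g(\boldsymbol{a}_v,\boldsymbol{b}_{v^c})$, where $(\boldsymbol{a}_v,\boldsymbol{b}_{v^c})$ has the coordinates $a_j$ for $j\in v$ and $b_j$ for $j\notin v$. For $g:[0,1]^d\to\mathbb{R}$ put $$V^{(d)}_\lambda(g)=\sup_{\mathcal P}\Bigl(\sum_{J\in\mathcal P}\mathrm{Vol}(J)\Bigl|\frac{\Delta(g,J)}{\mathrm{Vol}(J)^\lambda}\Bigr|^2\Bigr)^{1/2},$$ where $\mathcal P$ runs over the partitions of $[0,1)^d$ into finitely many nonempty boxes of this form. For nonempty $u\subseteq\{1,\dots,s\}$ and continuous $g:[0,1]^s\to\mathbb{R}$ put $$V^u_\lambda(g)=\sup_{\rho}V^{(|u|)}_\lambda\Bigl(\boldsymbol{x}_u\mapsto\int_{[0,1]^{s-|u|}}g(\boldsymbol{x})\prod_{j\notin u}\rho_j(x_j)\,d\boldsymbol{x}_{u^c}\Bigr),$$ where the supremum is over all families $(\rho_j)_{j\notin u}$ of continuous functions $\rho_j:[0,1]\to[0,1]$; for $u=\{1,\dots,s\}$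 this is $V^{(s)}_\lambda(g)$. **The constant.** Let $f\in C^{(\alpha,\dots,\alpha)}([0,1]^s)$ be real-valued; that is, for every $\boldsymbol{\beta}\in\{0,\dots,\alpha\}^s$ the mixed derivative $f^{(\boldsymbol{\beta})}=\partial^{\beta_1+\dots+\beta_s}f/\partial x_1^{\beta_1}\cdots\partial x_s^{\beta_s}$ exists and is continuous on $[0,1]^s$ (one-sided derivatives at the boundary). Put $$N_{\alpha,\lambda}(f)=\sup_{\emptyset\ne u\subseteq\{1,\dots,s\}}\Bigl(\sum_{\boldsymbol{\beta}\in\{0,\dots,\alpha\}^s}\bigl(V^u_\lambda(f^{(\boldsymbol{\beta})})\bigr)^2\Bigr)^{1/2}.$$ **Claim.** If $N_{\alpha,\lambda}(f)<\infty$, then for every $\boldsymbol{\ell}\in\mathbb{N}_0^s\setminus\{\boldsymbol{0}\}$ (some components may be zero), with $B_{\alpha,\boldsymbol{\ell},s}=\{\boldsymbol{k}\in\mathbb{N}_0^s\setminus\{\boldsymbol{0}\}\mid\lceil\boldsymbol{k}\rceil_{\alpha+1}=\boldsymbol{\ell}\}$, $$\Bigl(\sum_{\boldsymbol{k}\in B_{\alpha,\boldsymbol{\ell},s}}|\hat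 f(\boldsymbol{k})|^2\Bigr)^{1/2}\le N_{\alpha,\lambda}(f)\,2^{-(\alpha+\lambda)\sum_{j=1}^s\ell_j};$$ in particular the series converges. -/

import Mathlib

open MeasureTheory
open scoped ENNReal

noncomputable section

namespace FracWalsh

/-! ### Walsh coefficients -/

/-- The closed unit cube `[0,1]^ι`. -/
def unitCube (ι : Type*) : Set (ι → ℝ) := Set.Icc 0 1

/-- The set `κ ⊆ {1,2,…}` of nonzero bits of `k = ∑_{ℓ ≥ 1} a_ℓ 2^(ℓ-1)`. -/
def bitSet (k : ℕ) : Finset ℕ := k.bitIndices.toFinset.image (fun i => i + 1)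

/-- The `q`-th largest element of `κ` (`q ≥ 1`), and `0` if `q` exceeds the cardinality of `κ`. -/
def nthLargest (κ : Finset ℕ) (q : ℕ) : ℕ := (κ.sort (fun a b => b ≤ a)).getD (q - 1) 0

/-- The `ℓ`-th binary digit (`ℓ ≥ 1`) of `x ∈ [0,1)`, from the expansion with finitely many ones
when there are two. -/
def binDigit (ℓ : ℕ) (x : ℝ) : ℕ := ⌊(2 : ℝ) ^ ℓ * x⌋₊ % 2

/-- The univariate Walsh function `wal_k`. -/
def wal₁ (k : ℕ) (x : ℝ) : ℝ := (-1) ^ (∑ ℓ ∈ bitSet k, binDigit ℓ x)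

/-- The multivariate Walsh function `wal_k`, `k ∈ ℕ₀^s`. -/
def wal {s : ℕ} (k : Fin s → ℕ) (x : Fin s → ℝ) : ℝ := ∏ j, wal₁ (k j) (x j)

/-- The Walsh coefficient `f̂(k) = ∫_{[0,1]^s} f(x) wal_k(x) dx`. -/
def walshCoeff {s : ℕ} (f : (Fin s → ℝ) → ℝ) (k : Fin s → ℕ) : ℝ :=
  ∫ x in unitCube (Fin s), f x * wal k x

/-- The block `B_{α,ℓ,s}` of nonzero `k ∈ ℕ₀^s` such that, for every `j`, the `(α+1)`-st largest
nonzero bit of `k_j` is `ℓ_j`. -/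
def block {s : ℕ} (α : ℕ) (l : Fin s → ℕ) : Set (Fin s → ℕ) :=
  {k | k ≠ 0 ∧ ∀ j, nthLargest (bitSet (k j)) (α + 1) = l j}

/-! ### Dominating mixed derivatives on the closed cube

Only the values of a function on `[0,1]^s` matter; at the boundary the partial derivatives are
one-sided. -/

/-- The partial derivative `∂g/∂x_j` on `[0,1]^s`. -/
def partialDeriv {s : ℕ} (j : Fin s) (g : (Fin s → ℝ) → ℝ) : (Fin s → ℝ) → ℝ :=
  fun x => derivWithin (fun t => g (Function.update x j t)) (Set.Icc 0 1) (x j)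

/-- `g` has a partial derivative in the variable `x_j` at every point of `[0,1]^s`. -/
def HasPartial {s : ℕ} (j : Fin s) (g : (Fin s → ℝ) → ℝ) : Prop :=
  ∀ x ∈ unitCube (Fin s),
    DifferentiableWithinAt ℝ (fun t => g (Function.update x j t)) (Set.Icc 0 1) (x j)

/-- `f^(β) = ∂^{|β|} f / ∂x_1^{β_1} ⋯ ∂x_s^{β_s}`; the derivatives in the last variable are
taken first. -/
def mixedDeriv {s : ℕ} (f : (Fin s → ℝ) → ℝ) (β : Fin s → ℕ) : (Fin s → ℝ) → ℝ :=
  (List.finRange s).foldr (fun j g => (partialDeriv j)^[β j] g) f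

/-- `f ∈ C^(α,…,α)([0,1]^s)`: for all `β ∈ {0,…,α}^s` the derivative `f^(β)` exists and is
continuous on `[0,1]^s`. The second clause is the existence: if `β_i = 0` for all `i < j`, then
`f^(β + e_j)` is by definition the partial derivative of `f^(β)` in the variable `x_j`. -/
def IsCMixed {s : ℕ} (α : ℕ) (f : (Fin s → ℝ) → ℝ) : Prop :=
  ∀ β : Fin s → ℕ, (∀ j, β j ≤ α) →
    ContinuousOn (mixedDeriv f β) (unitCube (Fin s)) ∧
    ∀ j, β j < α → (∀ i < j, β i = 0) → HasPartial j (mixedDeriv f β)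

/-! ### Fractional variation -/

section Vitali

variable {ι : Type*} [Fintype ι] [DecidableEq ι]

/-- The box `∏_j [d_j, e_j)`. -/
def box (d e : ι → ℝ) : Set (ι → ℝ) := {x | ∀ j, x j ∈ Set.Ico (d j) (e j)}

/-- The volume `∏_j (e_j - d_j)` of a box. -/
def boxVol (d e : ι → ℝ) : ℝ := ∏ j, (e j - d j)

/-- The alternating sum `Δ(g, J)` of `g` over the vertices of `J = ∏_j [d_j, e_j)`. -/
def boxDelta (g : (ι → ℝ) → ℝ) (d e : ι → ℝ) : ℝ :=
  ∑ v : Finset ι, (-1) ^ (Fintype.card ι - v.card) * g (fun j => if j ∈ v then d j else e j)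

/-- `P` (a finite set of pairs of corners `(d, e)`) is a partition of `[0,1)^ι` into nonempty
boxes `∏_j [d_j, e_j)`. -/
structure IsBoxPartition (P : Finset ((ι → ℝ) × (ι → ℝ))) : Prop where
  lt : ∀ J ∈ P, ∀ j, J.1 j < J.2 j
  disjoint : ∀ J ∈ P, ∀ J' ∈ P, J ≠ J' → Disjoint (box J.1 J.2) (box J'.1 J'.2)
  cover : (⋃ J ∈ P, box J.1 J.2) = box (fun _ => 0) (fun _ => 1)

/-- The fractional Vitali variation of order `lam`. -/
def vitaliVar (lam : ℝ) (g : (ι → ℝ) → ℝ) : ℝ≥0∞ :=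
  ⨆ (P : Finset ((ι → ℝ) × (ι → ℝ))) (_ : IsBoxPartition P),
    (∑ J ∈ P, ENNReal.ofReal
      (boxVol J.1 J.2 * |boxDelta g J.1 J.2 / boxVol J.1 J.2 ^ lam| ^ 2)) ^ (1 / 2 : ℝ)

end Vitali

/-- The point of `ℝ^s` with coordinates `y` on `u` and `z` off `u`. -/
def glue {s : ℕ} (u : Finset (Fin s)) (y : {j // j ∈ u} → ℝ) (z : {j // j ∉ u} → ℝ) :
    Fin s → ℝ :=
  fun j => if h : j ∈ u then y ⟨j, h⟩ else z ⟨j, h⟩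

/-- `I_u(g)`: the variables outside `u` are integrated over `[0,1]`. -/
def partialInt {s : ℕ} (u : Finset (Fin s)) (g : (Fin s → ℝ) → ℝ) : ({j // j ∈ u} → ℝ) → ℝ :=
  fun y => ∫ z in unitCube {j // j ∉ u}, g (glue u y z)

/-- The factors of an element of `D_{u^c}`: continuous functions `[0,1] → [0,1]`, one for each
variable outside `u`. -/
def IsWeight {s : ℕ} (u : Finset (Fin s)) (ρ : {j // j ∉ u} → ℝ → ℝ) : Prop :=
  ∀ j, ContinuousOn (ρ j) (Set.Icc 0 1) ∧ ∀ t ∈ Set.Icc (0 : ℝ) 1, 0 ≤ ρ j t ∧ ρ j t ≤ 1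

/-- The fractional Vitali variation `V^u_lam(f)` with respect to `u`. If `u` is the set of all
variables, then the integral and the product of weights are trivial. -/
def marginalVar {s : ℕ} (lam : ℝ) (u : Finset (Fin s)) (f : (Fin s → ℝ) → ℝ) : ℝ≥0∞ :=
  ⨆ (ρ : {j // j ∉ u} → ℝ → ℝ) (_ : IsWeight u ρ),
    vitaliVar lam (partialInt u (fun x => f x * ∏ j, ρ j (x j.1)))

/-- `N_{α,lam}(f)`. -/
def fracNorm {s : ℕ} (α : ℕ) (lam : ℝ) (f : (Fin s → ℝ) → ℝ) : ℝ≥0∞ :=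
  ⨆ (u : Finset (Fin s)) (_ : u.Nonempty),
    (∑ β ∈ Fintype.piFinset (fun _ : Fin s => Finset.range (α + 1)),
      marginalVar lam u (mixedDeriv f β) ^ 2) ^ (1 / 2 : ℝ)

end FracWalsh

end

/-!
# Walsh coefficients of functions with finite fractional variation

Let `u` be the set of variables with `l j ≠ 0`. An index `k` of the block splits, in each variable,
into the digits `t j` above `l j`, the digit `l j` itself if it is nonzero, and the digits below
`l j`. The number `β j` of digits in `t j` is at most `α`, and equal to `α` for `j ∈ u`.

**Fixed upper digits.** A Walsh function is a product of Rademacher functions, and its finest factor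
has mean zero on the dyadic intervals on which the remaining ones are constant. Its primitive is
hence the product of the remaining factors with a nonnegative periodic function that vanishes at the
ends of those intervals (`prim_mul_of_periodic`). Integrating by parts `β j` times in each variable
(`iterate_prim_walS`, `abs_setIntegral_eq_mixedDeriv`) removes the digits `t j` one after the other:
up to sign, the coefficient is the integral of `f^(β)` against the Walsh function of the digits
`≤ l j`, times weights `triF (t j)`. These take values between `0` and `∏ a ∈ t j, 2^(-a)`, and have
the period `2^(-l j)`. For `j ∉ u` only the weight is left; after normalization it is one of the
weights in the definition of `marginalVar`. Integrating these variables out leaves a function `G` of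
the variables in `u` whose fractional variation is at most that of `f^(β)`.

**Fixed upper digits, sum over the lower ones.** The cube is tiled by the translates of a cell `T`
with sides `2^(-l j)`. Grouping these into blocks of `2^|u|`, the Rademacher factors of level `l j`
produce differences `Δ(G, J)` over boxes `J` with sides `2^(-l j)`, and the lower digits produce the
characters of a finite dyadic group (`sum_halfCells_eq_boxDelta`). The Cauchy-Schwarz inequality in
the position `t ∈ T` and Parseval's identity (`sum_sq_sum_walS`) reduce the square sum to
`∑ J, Δ(G, J)^2` over a grid shifted by `t`. Completed to a partition of the cube, this grid is
admissible in the fractional variation (`sum_shifted_boxDelta_sq_le`). The result is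
`sum_sq_setIntegral_walsh_le`, and with the preceding step `sum_sq_fixed_top_le`.

**Sum over the upper digits.** For given `β`, the squared bounds of the weights sum to at most
`∏ j, 4^(-β j * l j) = 4^(-α * ∑ j, l j)` (`sum_top_le`), since `∑_{a > l} 4^(-a) ≤ 4^(-l)`. The sum
over `β` is the one in `fracNorm`.
-/

noncomputable section

namespace FracWalsh

/-! ### Rademacher functions -/

/-- The Rademacher function `x ↦ (-1)^⌊2^a x⌋`, periodic on the whole line. On `[0, ∞)` its sign is
given by the `a`-th binary digit. -/
def rad (a : ℕ) (x : ℝ) : ℝ := if Even ⌊(2 : ℝ) ^ a * x⌋ then 1 else -1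

/-- The Walsh function of a set of digit positions. -/
def walS (S : Finset ℕ) (x : ℝ) : ℝ := ∏ a ∈ S, rad a x

/-- The product of the Rademacher functions of a list of digit positions. -/
def walL (L : List ℕ) (x : ℝ) : ℝ := (L.map fun a => rad a x).prod

lemma measurable_rad (a : ℕ) : Measurable (rad a) := by
  unfold rad
  refine Measurable.ite ?_ measurable_const measurable_const
  exact (Int.measurable_floor.comp (measurable_const_mul _))
    (MeasurableSet.of_discrete (s := {n : ℤ | Even n}))

lemma rad_mul_self (a : ℕ) (x : ℝ) : rad a x * rad a x = 1 := by
  unfold rad; split_ifs <;> norm_num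

lemma abs_rad (a : ℕ) (x : ℝ) : |rad a x| = 1 := by
  unfold rad; split_ifs <;> norm_num

lemma rad_add_half (a : ℕ) (x : ℝ) : rad a (x + ((2 : ℝ) ^ a)⁻¹) = -rad a x := by
  have : (2 : ℝ) ^ a * (x + ((2 : ℝ) ^ a)⁻¹) = 2 ^ a * x + 1 := by field_simp
  unfold rad
  rw [this, Int.floor_add_one]
  simp only [Int.even_add_one]
  split_ifs <;> simp_all

lemma rad_of_floor_eq {n a : ℕ} (ha : a ≤ n) {x y : ℝ} (h : ⌊(2 : ℝ) ^ n * x⌋ = ⌊(2 : ℝ) ^ n * y⌋) :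
    rad a x = rad a y := by
  have key : ∀ z : ℝ, ⌊(2 : ℝ) ^ a * z⌋ = ⌊(2 : ℝ) ^ n * z⌋ / ((2 ^ (n - a) : ℕ) : ℤ) := by
    intro z
    rw [← Int.floor_div_natCast]
    congr 1
    obtain ⟨m, rfl⟩ := Nat.exists_eq_add_of_le ha
    rw [Nat.add_sub_cancel_left]
    push_cast
    rw [pow_add]
    field_simp
  unfold rad
  rw [key x, key y, h]

lemma walS_of_floor_eq {n : ℕ} {S : Finset ℕ} (hS : ∀ a ∈ S, a ≤ n) {x y : ℝ}
    (h : ⌊(2 : ℝ) ^ n * x⌋ = ⌊(2 : ℝ) ^ n * y⌋) : walS S x = walS S y :=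
  Finset.prod_congr rfl fun a ha => rad_of_floor_eq (hS a ha) h

lemma walL_of_floor_eq {n : ℕ} {L : List ℕ} (hL : ∀ a ∈ L, a ≤ n) {x y : ℝ}
    (h : ⌊(2 : ℝ) ^ n * x⌋ = ⌊(2 : ℝ) ^ n * y⌋) : walL L x = walL L y := by
  unfold walL
  congr 1
  exact List.map_congr_left fun a ha => rad_of_floor_eq (hL a ha) h

lemma floor_two_pow_eq_of_rad_eq {n : ℕ} {x y : ℝ} (h0 : ⌊x⌋ = ⌊y⌋)
    (h : ∀ a, 1 ≤ a → a ≤ n → rad a x = rad a y) : ⌊(2 : ℝ) ^ n * x⌋ = ⌊(2 : ℝ) ^ n * y⌋ := by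
  induction n with
  | zero => simpa using h0
  | succ n ih =>
    have ih' := ih fun a h1 h2 => h a h1 (by omega)
    have hr := h (n + 1) (by omega) le_rfl
    have key : ∀ z : ℝ, ⌊(2 : ℝ) ^ n * z⌋ = ⌊(2 : ℝ) ^ (n + 1) * z⌋ / 2 := by
      intro z
      have := Int.floor_div_natCast ((2 : ℝ) ^ (n + 1) * z) 2
      push_cast at this
      rw [← this]
      congr 1
      ring
    rw [key x, key y] at ih'
    unfold rad at hr
    have hpar : Even ⌊(2 : ℝ) ^ (n + 1) * x⌋ ↔ Even ⌊(2 : ℝ) ^ (n + 1) * y⌋ := by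
      split_ifs at hr <;> first | tauto | (norm_num at hr)
    rw [Int.even_iff, Int.even_iff] at hpar
    omega

lemma measurable_walS (S : Finset ℕ) : Measurable (walS S) :=
  Finset.measurable_prod _ fun a _ => measurable_rad a

lemma abs_walS (S : Finset ℕ) (x : ℝ) : |walS S x| = 1 := by
  simp [walS, Finset.abs_prod, abs_rad]

lemma wal₁_eq_walS (k : ℕ) {x : ℝ} (hx : 0 ≤ x) : wal₁ k x = walS (bitSet k) x := by
  unfold wal₁ walS
  rw [← Finset.prod_pow_eq_pow_sum]
  refine Finset.prod_congr rfl fun a _ => ?_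
  have h0 : (0 : ℝ) ≤ 2 ^ a * x := by positivity
  have h1 : (⌊(2 : ℝ) ^ a * x⌋ : ℤ) = (⌊(2 : ℝ) ^ a * x⌋₊ : ℤ) :=
    (Int.natCast_floor_eq_floor h0).symm
  unfold rad binDigit
  simp only [h1, Int.even_coe_nat, Nat.even_iff]
  rcases Nat.mod_two_eq_zero_or_one ⌊(2 : ℝ) ^ a * x⌋₊ with h | h <;> simp [h]

lemma bitSet_injective : Function.Injective bitSet := by
  intro k k' h
  have := Finset.image_injective (add_left_injective 1) h
  exact Finset.equivBitIndices.injective this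

lemma one_le_of_mem_bitSet {k a : ℕ} (h : a ∈ bitSet k) : 1 ≤ a := by
  obtain ⟨i, -, rfl⟩ := Finset.mem_image.1 h
  omega

/-! ### Primitives -/

/-- The primitive vanishing at the origin. -/
def prim (φ : ℝ → ℝ) (x : ℝ) : ℝ := ∫ t in (0 : ℝ)..x, φ t

/-- Measurable functions on the line that are bounded on bounded sets. -/
def LocBdd (φ : ℝ → ℝ) : Prop :=
  Measurable φ ∧ ∀ R : ℝ, ∃ C : ℝ, ∀ x, |x| ≤ R → |φ x| ≤ C

lemma LocBdd.intervalIntegrable {φ : ℝ → ℝ} (h : LocBdd φ) (a b : ℝ) :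
    IntervalIntegrable φ volume a b := by
  obtain ⟨C, hC⟩ := h.2 (max |a| |b|)
  refine intervalIntegrable_const (c := C) |>.mono_fun h.1.aestronglyMeasurable ?_
  filter_upwards [ae_restrict_mem measurableSet_uIoc] with x hx
  have h2 : |x| ≤ max |a| |b| := by
    have := Set.uIoc_subset_uIcc hx
    rw [Set.mem_uIcc] at this
    rcases this with ⟨h1, h2⟩ | ⟨h1, h2⟩
    · exact abs_le_max_abs_abs h1 h2
    · rw [max_comm]; exact abs_le_max_abs_abs h1 h2
  exact (hC x h2).trans (le_abs_self C)

lemma LocBdd.continuous_prim {φ : ℝ → ℝ} (h : LocBdd φ) : Continuous (prim φ) :=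
  intervalIntegral.continuous_primitive h.intervalIntegrable 0

lemma _root_.Continuous.locBdd {φ : ℝ → ℝ} (h : Continuous φ) : LocBdd φ := by
  refine ⟨h.measurable, fun R => ?_⟩
  obtain ⟨C, hC⟩ := (isCompact_Icc (a := -R) (b := R)).exists_bound_of_continuousOn h.continuousOn
  exact ⟨C, fun x hx => hC x (abs_le.1 hx)⟩

lemma LocBdd.mul {φ ψ : ℝ → ℝ} (h : LocBdd φ) (h' : LocBdd ψ) : LocBdd fun x => φ x * ψ x := by
  refine ⟨h.1.mul h'.1, fun R => ?_⟩
  obtain ⟨C, hC⟩ := h.2 R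
  obtain ⟨C', hC'⟩ := h'.2 R
  refine ⟨C * C', fun x hx => ?_⟩
  rw [abs_mul]
  exact mul_le_mul (hC x hx) (hC' x hx) (abs_nonneg _) ((abs_nonneg _).trans (hC x hx))

lemma locBdd_rad (a : ℕ) : LocBdd (rad a) :=
  ⟨measurable_rad a, fun _ => ⟨1, fun x _ => (abs_rad a x).le⟩⟩

lemma locBdd_walS (S : Finset ℕ) : LocBdd (walS S) :=
  ⟨measurable_walS S, fun _ => ⟨1, fun x _ => (abs_walS S x).le⟩⟩

lemma locBdd_walL (L : List ℕ) : LocBdd (walL L) := by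
  induction L with
  | nil => exact continuous_const.locBdd
  | cons a L ih =>
    have : walL (a :: L) = fun x => rad a x * walL L x := by funext x; simp [walL]
    rw [this]
    exact (locBdd_rad a).mul ih

lemma LocBdd.iterate_prim {φ : ℝ → ℝ} (h : LocBdd φ) (n : ℕ) : LocBdd (prim^[n] φ) := by
  induction n with
  | zero => exact h
  | succ n ih => rw [Function.iterate_succ_apply']; exact ih.continuous_prim.locBdd

lemma prim_congr {φ ψ : ℝ → ℝ} (h : Set.EqOn φ ψ (Set.Icc 0 1)) :
    Set.EqOn (prim φ) (prim ψ) (Set.Icc 0 1) := by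
  intro x hx
  refine intervalIntegral.integral_congr fun t ht => h ?_
  rw [Set.uIcc_of_le hx.1] at ht
  exact ⟨ht.1, ht.2.trans hx.2⟩

/-- A factor that is constant on the periods of a periodic function of mean zero commutes with
taking the primitive. -/
lemma prim_mul_of_periodic {ψ c : ℝ → ℝ} {p : ℝ} (hp : 0 < p) (hψ : LocBdd ψ) (hc : LocBdd c)
    (hper : Function.Periodic ψ p) (hzero : ∫ t in (0 : ℝ)..p, ψ t = 0)
    (hcc : ∀ x y, ⌊x / p⌋ = ⌊y / p⌋ → c x = c y) {x : ℝ} (hx : 0 ≤ x) :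
    prim (fun t => ψ t * c t) x = prim ψ x * c x := by
  have cell : ∀ (m : ℕ) (d : ℝ → ℝ), (∀ x y, ⌊x / p⌋ = ⌊y / p⌋ → d x = d y) →
      ∀ z, m * p ≤ z → z ≤ (m + 1) * p →
      ∫ t in (m * p)..z, ψ t * d t = (∫ t in (m * p)..z, ψ t) * d (m * p) := by
    intro m d hdd z hz hz'
    rw [← intervalIntegral.integral_mul_const]
    refine intervalIntegral.integral_congr_Ioo_of_le hz fun t ht => ?_
    rw [hdd t (m * p)]
    rw [mul_div_assoc, div_self hp.ne', mul_one, Int.floor_natCast, Int.floor_eq_iff]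
    constructor
    · rw [le_div_iff₀ hp]; exact_mod_cast ht.1.le
    · rw [div_lt_iff₀ hp]; exact_mod_cast ht.2.trans_le hz'
  have main : ∀ (d : ℝ → ℝ), LocBdd d → (∀ x y, ⌊x / p⌋ = ⌊y / p⌋ → d x = d y) → ∀ m : ℕ,
      ∫ t in (0 : ℝ)..(m * p), ψ t * d t = 0 := by
    intro d hd hdd m
    induction m with
    | zero => simp
    | succ m ih =>
      rw [← intervalIntegral.integral_add_adjacent_intervals
        ((hψ.mul hd).intervalIntegrable 0 (m * p)) ((hψ.mul hd).intervalIntegrable _ _),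
        ih, zero_add,
        Nat.cast_succ, cell m d hdd _ (by nlinarith) le_rfl]
      have := hper.intervalIntegral_add_eq (m * p) 0
      rw [add_mul, one_mul, this, zero_add, hzero, zero_mul]
  obtain ⟨m, hm1, hm2⟩ : ∃ m : ℕ, m * p ≤ x ∧ x < (m + 1) * p := by
    refine ⟨⌊x / p⌋₊, ?_, ?_⟩
    · rw [← le_div_iff₀ hp]; exact Nat.floor_le (by positivity)
    · rw [← div_lt_iff₀ hp]; exact Nat.lt_floor_add_one _
  have one := main (fun _ => 1) continuous_const.locBdd (fun _ _ _ => rfl) m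
  simp only [mul_one] at one
  unfold prim
  rw [← intervalIntegral.integral_add_adjacent_intervals
        ((hψ.mul hc).intervalIntegrable 0 (m * p)) ((hψ.mul hc).intervalIntegrable _ _),
    ← intervalIntegral.integral_add_adjacent_intervals
        (hψ.intervalIntegrable 0 (m * p)) (hψ.intervalIntegrable _ _), one, main c hc hcc m,
    zero_add, zero_add, cell m c hcc x hm1 hm2.le]
  congr 1
  apply hcc
  rw [mul_div_assoc, div_self hp.ne', mul_one, Int.floor_natCast, eq_comm, Int.floor_eq_iff]
  constructor
  · rw [le_div_iff₀ hp]; exact_mod_cast hm1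
  · rw [div_lt_iff₀ hp]; exact_mod_cast hm2

/-! ### Iterated primitives of Walsh functions -/

/-- The iterated primitive of the Rademacher functions of an increasing list of digit positions:
the last (finest) one is integrated first, and each further one is multiplied in before the next
integration. -/
def triW : List ℕ → ℝ → ℝ
  | [] => fun _ => 1
  | a :: L => prim fun t => rad a t * triW L t

lemma continuous_triW (L : List ℕ) : Continuous (triW L) := by
  induction L with
  | nil => exact continuous_const
  | cons a L ih => exact ((locBdd_rad a).mul ih.locBdd).continuous_prim

lemma rad_periodic (a : ℕ) : Function.Periodic (rad a) (2 * ((2 : ℝ) ^ a)⁻¹) := by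
  intro x
  rw [two_mul, ← add_assoc, rad_add_half, rad_add_half, neg_neg]

lemma rad_eq_one {a : ℕ} {x : ℝ} (h0 : 0 ≤ x) (h1 : x < ((2 : ℝ) ^ a)⁻¹) : rad a x = 1 := by
  have : ⌊(2 : ℝ) ^ a * x⌋ = 0 := by
    rw [Int.floor_eq_iff]
    refine ⟨by simp; positivity, ?_⟩
    have := mul_lt_mul_of_pos_left h1 (show (0 : ℝ) < 2 ^ a by positivity)
    rw [mul_inv_cancel₀ (by positivity)] at this
    simpa using this
  simp [rad, this]

lemma integral_rad_mul_first {a : ℕ} {w : ℝ → ℝ} {x : ℝ} (h0 : 0 ≤ x) (h1 : x ≤ ((2 : ℝ) ^ a)⁻¹) :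
    ∫ t in (0 : ℝ)..x, rad a t * w t = ∫ t in (0 : ℝ)..x, w t := by
  refine intervalIntegral.integral_congr_Ioo_of_le h0 fun t ht => ?_
  rw [rad_eq_one ht.1.le (ht.2.trans_le h1), one_mul]

lemma integral_rad_mul_second {a : ℕ} {w : ℝ → ℝ} (hw : LocBdd w)
    (hper : Function.Periodic w ((2 : ℝ) ^ a)⁻¹) {x : ℝ} (h0 : 0 ≤ x) (h1 : x ≤ ((2 : ℝ) ^ a)⁻¹) :
    ∫ t in (0 : ℝ)..(x + ((2 : ℝ) ^ a)⁻¹), rad a t * w t = ∫ t in x..((2 : ℝ) ^ a)⁻¹, w t := by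
  set h := ((2 : ℝ) ^ a)⁻¹ with hh
  have hpos : 0 < h := by positivity
  have hI := (locBdd_rad a).mul hw
  rw [← intervalIntegral.integral_add_adjacent_intervals (hI.intervalIntegrable 0 h)
    (hI.intervalIntegrable h (x + h)), integral_rad_mul_first hpos.le le_rfl]
  have e1 : ∫ t in h..(x + h), rad a t * w t = -∫ t in (0 : ℝ)..x, w t := by
    have := intervalIntegral.integral_comp_add_right (a := 0) (b := x) (fun t => rad a t * w t) h
    rw [zero_add] at this
    rw [← this, ← integral_rad_mul_first (w := w) h0 h1, ← intervalIntegral.integral_neg]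
    refine intervalIntegral.integral_congr fun t _ => ?_
    rw [hh, rad_add_half, ← hh, hper t, neg_mul]
  rw [e1, ← intervalIntegral.integral_add_adjacent_intervals (hw.intervalIntegrable 0 x)
    (hw.intervalIntegrable x h)]
  ring

lemma periodic_prim {ψ : ℝ → ℝ} {p : ℝ} (hψ : LocBdd ψ)
    (hper : Function.Periodic ψ p) (hzero : ∫ t in (0 : ℝ)..p, ψ t = 0) :
    Function.Periodic (prim ψ) p := by
  intro x
  unfold prim
  rw [← intervalIntegral.integral_add_adjacent_intervals (hψ.intervalIntegrable 0 x)
    (hψ.intervalIntegrable x (x + p)), hper.intervalIntegral_add_eq x 0, zero_add, hzero, add_zero]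

lemma two_pow_inv_eq_nsmul {a b : ℕ} (h : a ≤ b) :
    ((2 : ℝ) ^ a)⁻¹ = ((2 ^ (b - a) : ℕ) : ℝ) * ((2 : ℝ) ^ b)⁻¹ := by
  obtain ⟨m, rfl⟩ := Nat.exists_eq_add_of_le h
  rw [Nat.add_sub_cancel_left, pow_add]
  push_cast
  field_simp

/-- The two properties support each other in the induction: `triW L` is periodic because the
integrand of its last integration has mean zero, and the integrand of the next integration has mean
zero because `triW L` is periodic of half the period of the new Rademacher factor. -/
lemma triW_periodic_and_mean {L : List ℕ} (hL : L.Pairwise (· < ·)) :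
    (∀ b, (∀ c ∈ L, b < c) → Function.Periodic (triW L) ((2 : ℝ) ^ b)⁻¹) ∧
    ∀ a, (∀ c ∈ L, a < c) → ∫ t in (0 : ℝ)..(2 * ((2 : ℝ) ^ a)⁻¹), rad a t * triW L t = 0 := by
  induction L with
  | nil =>
    refine ⟨fun b _ x => rfl, fun a _ => ?_⟩
    rw [two_mul, integral_rad_mul_second (continuous_triW []).locBdd (fun x => rfl) (by positivity)
      le_rfl, intervalIntegral.integral_same]
  | cons c L ih =>
    rw [List.pairwise_cons] at hL
    obtain ⟨ih1, ih2⟩ := ih hL.2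
    have hper : ∀ b, (∀ d ∈ c :: L, b < d) → Function.Periodic (triW (c :: L)) ((2 : ℝ) ^ b)⁻¹ := by
      intro b hb
      have hbc : b + 1 ≤ c := hb c (by simp)
      have h1 : Function.Periodic (triW (c :: L)) (2 * ((2 : ℝ) ^ c)⁻¹) := by
        refine periodic_prim ((locBdd_rad c).mul (continuous_triW L).locBdd) ?_ (ih2 c hL.1)
        intro x
        simp only
        rw [rad_periodic c x]
        congr 1
        simpa [two_mul, add_assoc] using (ih1 c hL.1).nat_mul 2 x
      have h2 := h1.nat_mul (2 ^ (c - (b + 1)))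
      have h3 : ((2 : ℝ) ^ b)⁻¹ = ((2 ^ (c - (b + 1)) : ℕ) : ℝ) * (2 * ((2 : ℝ) ^ c)⁻¹) := by
        have := two_pow_inv_eq_nsmul hbc
        rw [mul_left_comm, ← this, pow_succ]
        field_simp
      rw [h3]; exact h2
    refine ⟨hper, fun a ha => ?_⟩
    rw [two_mul, integral_rad_mul_second (continuous_triW _).locBdd (hper a ha) (by positivity)
      le_rfl, intervalIntegral.integral_same]

lemma triW_nonneg_and_le {L : List ℕ} (hL : L.Pairwise (· < ·)) (x : ℝ) :
    0 ≤ triW L x ∧ triW L x ≤ (L.map fun a => ((2 : ℝ) ^ a)⁻¹).prod := by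
  induction L generalizing x with
  | nil => simp [triW]
  | cons a L ih =>
    rw [List.pairwise_cons] at hL
    set h := ((2 : ℝ) ^ a)⁻¹ with hh
    set C := (L.map fun a => ((2 : ℝ) ^ a)⁻¹).prod with hC
    have hpos : 0 < h := by positivity
    have hP := triW_periodic_and_mean hL.2
    have hw := (continuous_triW L).locBdd
    have hper : Function.Periodic (triW (a :: L)) (2 * h) := by
      refine periodic_prim ((locBdd_rad a).mul hw) ?_ (hP.2 a hL.1)
      intro x
      simp only
      rw [rad_periodic a x]
      congr 1
      simpa [two_mul, add_assoc] using (hP.1 a hL.1).nat_mul 2 x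
    have hint : ∀ {y z : ℝ}, 0 ≤ y → y ≤ z → z ≤ h →
        0 ≤ ∫ t in y..z, triW L t ∧ ∫ t in y..z, triW L t ≤ h * C := by
      intro y z h0 h1 h2
      have hC0 : 0 ≤ C := (ih hL.2 0).1.trans (ih hL.2 0).2
      refine ⟨intervalIntegral.integral_nonneg h1 fun t _ => (ih hL.2 t).1, ?_⟩
      calc ∫ t in y..z, triW L t ≤ ∫ t in y..z, C :=
            intervalIntegral.integral_mono_on h1 (hw.intervalIntegrable _ _) (by simp)
              fun t _ => (ih hL.2 t).2
        _ = (z - y) * C := by simp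
        _ ≤ h * C := by gcongr; linarith
    obtain ⟨y, hy, hxy⟩ := hper.exists_mem_Ico₀ (by positivity) x
    rw [hxy, List.map_cons, List.prod_cons]
    rcases le_total y h with hyh | hyh
    · have : triW (a :: L) y = ∫ t in (0 : ℝ)..y, triW L t := integral_rad_mul_first hy.1 hyh
      rw [this]
      exact hint le_rfl hy.1 hyh
    · have : triW (a :: L) y = ∫ t in (y - h)..h, triW L t := by
        have := integral_rad_mul_second hw (hP.1 a hL.1) (x := y - h) (by linarith)
          (by linarith [hy.2])
        rwa [sub_add_cancel] at this
      rw [this]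
      exact hint (by linarith) (by linarith [hy.2]) le_rfl

lemma prim_rad_mul_triW_mul {a : ℕ} {P : List ℕ} (hP : (a :: P).Pairwise (· < ·)) {c : ℝ → ℝ}
    (hc : LocBdd c) (hcc : ∀ x y, ⌊(2 : ℝ) ^ (a - 1) * x⌋ = ⌊(2 : ℝ) ^ (a - 1) * y⌋ → c x = c y)
    (ha : 1 ≤ a) {x : ℝ} (hx : 0 ≤ x) :
    prim (fun t => (rad a t * triW P t) * c t) x = triW (a :: P) x * c x := by
  rw [List.pairwise_cons] at hP
  have hm := triW_periodic_and_mean hP.2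
  refine prim_mul_of_periodic (p := 2 * ((2 : ℝ) ^ a)⁻¹) (by positivity)
    ((locBdd_rad a).mul (continuous_triW P).locBdd) hc ?_ (hm.2 a hP.1) ?_ hx
  · intro x
    simp only
    rw [rad_periodic a x]
    congr 1
    simpa [two_mul, add_assoc] using (hm.1 a hP.1).nat_mul 2 x
  · intro x y hxy
    apply hcc
    have : ∀ z : ℝ, (2 : ℝ) ^ (a - 1) * z = z / (2 * ((2 : ℝ) ^ a)⁻¹) := by
      intro z
      obtain ⟨m, rfl⟩ := Nat.exists_eq_add_of_le ha
      rw [Nat.add_sub_cancel_left, pow_add]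
      field_simp
    rw [this, this, hxy]

/-- The iterated primitives of a Walsh function, in the form needed for repeated integration by
parts: they integrate the finest digits one after the other, and all of them vanish at `1`. -/
lemma iterate_prim_walsh (D : List ℕ) : ∀ (P : List ℕ) (R : Finset ℕ) (φ : ℝ → ℝ),
    (D.reverse ++ P).Pairwise (· < ·) → (∀ a ∈ D, ∀ r ∈ R, r < a) → (∀ a ∈ D, 1 ≤ a) →
    Set.EqOn φ (fun x => triW P x * walL D x * walS R x) (Set.Icc 0 1) →
    Set.EqOn (prim^[D.length] φ) (fun x => triW (D.reverse ++ P) x * walS R x) (Set.Icc 0 1) ∧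
      ∀ m, 1 ≤ m → m ≤ D.length → prim^[m] φ 1 = 0 := by
  induction D with
  | nil =>
    intro P R φ _ _ _ h
    refine ⟨fun x hx => ?_, fun m h1 h2 => ?_⟩
    · simpa [walL] using h hx
    · simp at h2; omega
  | cons a D ih =>
    intro P R φ hP hR hpos hφ
    rw [List.reverse_cons, List.append_assoc, List.singleton_append] at hP ⊢
    have haP : (a :: P).Pairwise (· < ·) := (List.pairwise_append.1 hP).2.1
    have hDa : ∀ d ∈ D, d < a := fun d hd =>
      (List.pairwise_append.1 hP).2.2 d (List.mem_reverse.2 hd) a (by simp)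
    have ha1 : 1 ≤ a := hpos a (by simp)
    have step : Set.EqOn (prim φ) (fun x => triW (a :: P) x * walL D x * walS R x)
        (Set.Icc 0 1) := by
      intro x hx
      have h2 := prim_rad_mul_triW_mul haP (c := fun x => walL D x * walS R x)
        ((locBdd_walL D).mul (locBdd_walS R)) ?_ ha1 hx.1
      · rw [prim_congr hφ hx]
        simp only [mul_assoc] at h2 ⊢
        rw [← h2]
        refine intervalIntegral.integral_congr fun t _ => ?_
        simp only [walL, List.map_cons, List.prod_cons]
        ring
      · intro x y hxy
        rw [walL_of_floor_eq (fun d hd => by have := hDa d hd; omega) hxy,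
          walS_of_floor_eq (fun r hr => by have := hR a (by simp) r hr; omega) hxy]
    have htri1 : triW (a :: P) 1 = 0 := by
      have h1 := (triW_periodic_and_mean haP).1 0 (fun c hc => by
        rcases List.mem_cons.1 hc with rfl | hc
        · omega
        · have := (List.pairwise_cons.1 haP).1 c hc; omega) 0
      simp only [pow_zero, inv_one, zero_add] at h1
      rw [h1]
      simp [triW, prim]
    obtain ⟨r1, r2⟩ := ih (a :: P) R (prim φ) hP (fun d hd => hR d (by simp [hd]))
      (fun d hd => hpos d (by simp [hd])) step
    refine ⟨fun x hx => ?_, fun m h1 h2 => ?_⟩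
    · rw [List.length_cons, Function.iterate_succ_apply]
      exact r1 hx
    · obtain ⟨m, rfl⟩ : ∃ n, m = n + 1 := ⟨m - 1, by omega⟩
      rw [Function.iterate_succ_apply]
      rcases Nat.eq_zero_or_pos m with rfl | hm
      · rw [Function.iterate_zero_apply, step (by simp)]
        simp [htri1]
      · exact r2 m hm (by simp at h2; omega)

/-! ### Integration by parts -/

lemma intervalIntegral_mul_eq_neg_deriv_mul_prim {g φ : ℝ → ℝ}
    (hg : ∀ t ∈ Set.Icc (0 : ℝ) 1, DifferentiableWithinAt ℝ g (Set.Icc 0 1) t)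
    (hg' : ContinuousOn (derivWithin g (Set.Icc 0 1)) (Set.Icc 0 1))
    (hφ : LocBdd φ) (h1 : prim φ 1 = 0) :
    ∫ t in (0 : ℝ)..1, g t * φ t =
      -∫ t in (0 : ℝ)..1, derivWithin g (Set.Icc 0 1) t * prim φ t := by
  have hac : AbsolutelyContinuousOnInterval g 0 1 := by
    apply ContDiffOn.absolutelyContinuousOnInterval
    rw [Set.uIcc_of_le zero_le_one,
      show (1 : WithTop ℕ∞) = 0 + 1 by rfl,
      contDiffOn_succ_iff_derivWithin (uniqueDiffOn_Icc zero_lt_one)]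
    exact ⟨fun t ht => hg t ht, by simp, contDiffOn_zero.2 hg'⟩
  have hac2 : AbsolutelyContinuousOnInterval (prim φ) 0 1 :=
    (hφ.intervalIntegrable 0 1).absolutelyContinuousOnInterval_intervalIntegral (by simp)
  have key := hac.integral_mul_deriv_eq_deriv_mul hac2
  have h0 : prim φ 0 = 0 := by simp [prim]
  rw [h1, h0, mul_zero, mul_zero, sub_zero, zero_sub] at key
  have e1 : ∫ t in (0 : ℝ)..1, g t * φ t = ∫ t in (0 : ℝ)..1, g t * deriv (prim φ) t := by
    refine intervalIntegral.integral_congr_ae ?_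
    filter_upwards [(hφ.intervalIntegrable 0 1).ae_hasDerivAt_integral] with t ht hmem
    have h2 : HasDerivAt (prim φ) (φ t) t := ht (Set.uIoc_subset_uIcc hmem) 0 (by simp)
    rw [h2.deriv]
  rw [e1, key]
  congr 1
  refine intervalIntegral.integral_congr_Ioo_of_le zero_le_one fun t ht => ?_
  rw [derivWithin_of_mem_nhds (Icc_mem_nhds ht.1 ht.2)]

lemma isCompact_unitCube (ι : Type*) : IsCompact (unitCube ι) := by
  have : unitCube ι = Set.pi Set.univ fun _ => Set.Icc (0 : ℝ) 1 := by
    rw [unitCube, ← Set.pi_univ_Icc]; rfl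
  rw [this]
  exact isCompact_univ_pi fun _ => isCompact_Icc

lemma measurableSet_unitCube (ι : Type*) [Countable ι] : MeasurableSet (unitCube ι) :=
  (isCompact_unitCube ι).measurableSet

lemma mem_unitCube {ι : Type*} {x : ι → ℝ} : x ∈ unitCube ι ↔ ∀ j, x j ∈ Set.Icc (0 : ℝ) 1 := by
  simp only [unitCube, Set.mem_Icc, Pi.le_def, forall_and]
  rfl

lemma exists_bound_prod {ι : Type*} [Fintype ι] {φ : ι → ℝ → ℝ} (hφ : ∀ j, LocBdd (φ j)) :
    ∃ C, ∀ x ∈ unitCube ι, |∏ j, φ j (x j)| ≤ C := by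
  choose C hC using fun j => (hφ j).2 1
  refine ⟨∏ j, C j, fun x hx => ?_⟩
  rw [Finset.abs_prod]
  refine Finset.prod_le_prod (fun _ _ => abs_nonneg _) fun j _ => hC j _ ?_
  have := mem_unitCube.1 hx j
  rw [abs_of_nonneg this.1]; exact this.2

lemma integrableOn_mul_prod {ι : Type*} [Fintype ι] {g : (ι → ℝ) → ℝ}
    (hg : ContinuousOn g (unitCube ι)) {φ : ι → ℝ → ℝ} (hφ : ∀ j, LocBdd (φ j)) :
    IntegrableOn (fun x => g x * ∏ j, φ j (x j)) (unitCube ι) := by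
  obtain ⟨C, hC⟩ := exists_bound_prod hφ
  obtain ⟨C', hC'⟩ := (isCompact_unitCube ι).exists_bound_of_continuousOn hg
  have hm : Measurable fun x : ι → ℝ => ∏ j, φ j (x j) :=
    Finset.measurable_prod _ fun j _ => (hφ j).1.comp (measurable_pi_apply j)
  have : IsFiniteMeasure (volume.restrict (unitCube ι)) :=
    ⟨by simpa using (isCompact_unitCube ι).measure_lt_top⟩
  refine Integrable.of_bound ?_ (C' * C) ?_
  · exact (hg.aestronglyMeasurable (measurableSet_unitCube ι)).mul hm.aestronglyMeasurable
  · filter_upwards [ae_restrict_mem (measurableSet_unitCube ι)] with x hx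
    rw [norm_mul]
    exact mul_le_mul (hC' x hx) (hC x hx) (norm_nonneg _) ((norm_nonneg _).trans (hC' x hx))

lemma setIntegral_unitCube_succ {n : ℕ} (j : Fin (n + 1)) {H : (Fin (n + 1) → ℝ) → ℝ}
    (hH : IntegrableOn H (unitCube (Fin (n + 1)))) :
    ∫ x in unitCube (Fin (n + 1)), H x =
      ∫ z in unitCube (Fin n), ∫ t in (0 : ℝ)..1, H (j.insertNth t z) := by
  set e := MeasurableEquiv.piFinSuccAbove (fun _ : Fin (n + 1) => ℝ) j with he
  have hmp : MeasurePreserving e.symm (volume.prod volume) volume :=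
    (volume_preserving_piFinSuccAbove (fun _ : Fin (n + 1) => ℝ) j).symm
  have hsymm : ∀ p : ℝ × (Fin n → ℝ), e.symm p = j.insertNth p.1 p.2 := fun p => rfl
  have hpre : e.symm ⁻¹' unitCube (Fin (n + 1)) = Set.Icc (0 : ℝ) 1 ×ˢ unitCube (Fin n) := by
    ext ⟨t, z⟩
    simp only [Set.mem_preimage, hsymm, mem_unitCube, Set.mem_prod, Fin.forall_iff_succAbove j,
      Fin.insertNth_apply_same, Fin.insertNth_apply_succAbove]
  rw [← hmp.setIntegral_preimage_emb e.symm.measurableEmbedding, hpre, ← setIntegral_prod_swap,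
    setIntegral_prod]
  · refine setIntegral_congr_fun (measurableSet_unitCube _) fun z _ => ?_
    simp only [Prod.swap, hsymm]
    rw [intervalIntegral.integral_of_le zero_le_one, integral_Icc_eq_integral_Ioc]
  · have h1 : IntegrableOn (fun p => H (e.symm p)) (Set.Icc (0 : ℝ) 1 ×ˢ unitCube (Fin n))
        (volume.prod volume) := by
      rw [← hpre]
      exact (hmp.integrableOn_comp_preimage e.symm.measurableEmbedding).2 hH
    exact h1.swap

lemma insertNth_mem_unitCube {n : ℕ} {j : Fin (n + 1)} {t : ℝ} {z : Fin n → ℝ}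
    (ht : t ∈ Set.Icc (0 : ℝ) 1) (hz : z ∈ unitCube (Fin n)) :
    (j.insertNth t z : Fin (n + 1) → ℝ) ∈ unitCube (Fin (n + 1)) := by
  rw [mem_unitCube, Fin.forall_iff_succAbove j]
  simpa using ⟨ht, mem_unitCube.1 hz⟩

/-- Integration by parts in the variable `x_j` on the cube. There are no boundary terms, since the
primitive of the weight in the variable `x_j` vanishes at both ends. -/
lemma setIntegral_mul_prod_eq_neg_partialDeriv {s : ℕ} (j : Fin s) {g : (Fin s → ℝ) → ℝ}
    (hg : ContinuousOn g (unitCube (Fin s))) (hd : HasPartial j g)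
    (hg' : ContinuousOn (partialDeriv j g) (unitCube (Fin s)))
    {φ : Fin s → ℝ → ℝ} (hφ : ∀ i, LocBdd (φ i)) (h1 : prim (φ j) 1 = 0) :
    ∫ x in unitCube (Fin s), g x * ∏ i, φ i (x i) =
      -∫ x in unitCube (Fin s), partialDeriv j g x *
        ∏ i, Function.update φ j (prim (φ j)) i (x i) := by
  obtain ⟨n, rfl⟩ : ∃ n, s = n + 1 := ⟨s - 1, by have := j.pos; omega⟩
  have hφ' : ∀ i, LocBdd (Function.update φ j (prim (φ j)) i) := by
    intro i
    by_cases hi : i = j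
    · subst hi; rw [Function.update_self]; exact (hφ i).continuous_prim.locBdd
    · rw [Function.update_of_ne hi]; exact hφ i
  rw [setIntegral_unitCube_succ j (integrableOn_mul_prod hg hφ),
    setIntegral_unitCube_succ j (integrableOn_mul_prod hg' hφ'), ← integral_neg]
  refine setIntegral_congr_fun (measurableSet_unitCube _) fun z hz => ?_
  simp only [Fin.prod_univ_succAbove _ j, Fin.insertNth_apply_same, Fin.insertNth_apply_succAbove,
    Function.update_self, Function.update_of_ne (Fin.succAbove_ne j _), ← mul_assoc]
  rw [intervalIntegral.integral_mul_const, intervalIntegral.integral_mul_const, ← neg_mul]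
  congr 1
  have hpd : ∀ t, partialDeriv j g (j.insertNth t z) =
      derivWithin (fun t => g (j.insertNth t z)) (Set.Icc 0 1) t := by
    intro t
    simp only [partialDeriv, Fin.update_insertNth, Fin.insertNth_apply_same]
  have hins : ContinuousOn (fun t : ℝ => (j.insertNth t z : Fin (n + 1) → ℝ)) (Set.Icc 0 1) :=
    (Continuous.finInsertNth (A := fun _ => ℝ) j continuous_id continuous_const).continuousOn
  have hmaps : Set.MapsTo (fun t : ℝ => (j.insertNth t z : Fin (n + 1) → ℝ)) (Set.Icc 0 1)
      (unitCube _) := fun t ht => insertNth_mem_unitCube ht hz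
  rw [intervalIntegral_mul_eq_neg_deriv_mul_prim (g := fun t => g (j.insertNth t z)) _ _ (hφ j) h1]
  · simp only [hpd]
  · intro t ht
    have := hd _ (insertNth_mem_unitCube (j := j) ht hz)
    simpa only [Fin.update_insertNth, Fin.insertNth_apply_same] using this
  · have := hg'.comp hins hmaps
    refine this.congr fun t _ => ?_
    simp only [Function.comp, hpd]

/-- `mixedDeriv` takes the derivatives in the last variable first. Raising the order in the variable
`x_j` therefore amounts to one more outermost derivative only if no variable before `x_j` is
involved. -/
lemma foldr_partialDeriv_update {s : ℕ} (f : (Fin s → ℝ) → ℝ) (γ : Fin s → ℕ) (j : Fin s)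
    (hγ : ∀ i < j, γ i = 0) (L : List (Fin s)) (hL : L.Pairwise (· < ·)) :
    (j ∈ L → L.foldr (fun i g => (partialDeriv i)^[Function.update γ j (γ j + 1) i] g) f =
      partialDeriv j (L.foldr (fun i g => (partialDeriv i)^[γ i] g) f)) ∧
    (j ∉ L → L.foldr (fun i g => (partialDeriv i)^[Function.update γ j (γ j + 1) i] g) f =
      L.foldr (fun i g => (partialDeriv i)^[γ i] g) f) := by
  induction L with
  | nil => simp
  | cons i L ih =>
    rw [List.pairwise_cons] at hL
    have ih := ih hL.2
    simp only [List.foldr_cons]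
    by_cases hij : i = j
    · subst hij
      have hnot : i ∉ L := fun h => lt_irrefl _ (hL.1 i h)
      rw [ih.2 hnot, Function.update_self, Function.iterate_succ_apply']
      simp
    · rw [Function.update_of_ne hij]
      constructor
      · intro hj
        have hj : j ∈ L := by simpa [Ne.symm hij] using hj
        rw [ih.1 hj, hγ i (hL.1 j hj)]
        rfl
      · intro hj
        rw [ih.2 fun h => hj (by simp [h])]

lemma mixedDeriv_update {s : ℕ} (f : (Fin s → ℝ) → ℝ) (γ : Fin s → ℕ) (j : Fin s)
    (hγ : ∀ i < j, γ i = 0) :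
    mixedDeriv f (Function.update γ j (γ j + 1)) = partialDeriv j (mixedDeriv f γ) :=
  (foldr_partialDeriv_update f γ j hγ _ (List.pairwise_lt_finRange s)).1 (List.mem_finRange j)

lemma mixedDeriv_zero {s : ℕ} (f : (Fin s → ℝ) → ℝ) : mixedDeriv f 0 = f := by
  unfold mixedDeriv
  induction List.finRange s with
  | nil => rfl
  | cons i L ih => rw [List.foldr_cons, ih]; rfl

/-- Repeated integration by parts, `β_j` times in the variable `x_j`. -/
lemma abs_setIntegral_eq_mixedDeriv {s α : ℕ} {f : (Fin s → ℝ) → ℝ} (hf : IsCMixed α f)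
    {φ : Fin s → ℝ → ℝ} (hφ : ∀ j, LocBdd (φ j)) (β : Fin s → ℕ) (hβ : ∀ j, β j ≤ α)
    (hzero : ∀ j m, 1 ≤ m → m ≤ β j → prim^[m] (φ j) 1 = 0) :
    |∫ x in unitCube (Fin s), f x * ∏ j, φ j (x j)| =
      |∫ x in unitCube (Fin s), mixedDeriv f β x * ∏ j, (prim^[β j] (φ j)) (x j)| := by
  induction hn : ∑ j, β j generalizing β with
  | zero =>
    have : β = 0 := by
      funext j
      exact (Finset.sum_eq_zero_iff.1 hn) j (Finset.mem_univ j)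
    subst this
    simp [mixedDeriv_zero]
  | succ n ih =>
    -- The derivative taken last is the one in the variable of smallest index.
    obtain ⟨j, hj, hmin⟩ : ∃ j, β j ≠ 0 ∧ ∀ i < j, β i = 0 := by
      have hne : (Finset.univ.filter fun j => β j ≠ 0).Nonempty := by
        by_contra h
        rw [Finset.not_nonempty_iff_eq_empty, Finset.filter_eq_empty_iff] at h
        rw [Finset.sum_eq_zero fun j _ => by simpa using h (Finset.mem_univ j)] at hn
        omega
      refine ⟨_, (Finset.mem_filter.1 (Finset.min'_mem _ hne)).2, fun i hi => ?_⟩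
      by_contra h
      exact absurd (Finset.min'_le _ i (Finset.mem_filter.2 ⟨Finset.mem_univ i, h⟩)) (not_le.2 hi)
    set γ := Function.update β j (β j - 1) with hγ
    have hγj : γ j + 1 = β j := by rw [hγ, Function.update_self]; omega
    have hβγ : β = Function.update γ j (γ j + 1) := by
      rw [hγj, hγ, Function.update_idem, Function.update_eq_self]
    have hγi : ∀ i, i ≠ j → γ i = β i := fun i hi => by rw [hγ, Function.update_of_ne hi]
    have hγle : ∀ i, γ i ≤ β i := fun i => by
      by_cases hi : i = j
      · subst hi; omega
      · exact (hγi i hi).le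
    have hγ0 : ∀ i < j, γ i = 0 := fun i hi => by rw [hγi i hi.ne, hmin i hi]
    have hsum : ∑ j, γ j = n := by
      have h1 := Finset.add_sum_erase Finset.univ β (Finset.mem_univ j)
      have h2 := Finset.add_sum_erase Finset.univ γ (Finset.mem_univ j)
      have h3 : ∑ i ∈ Finset.univ.erase j, γ i = ∑ i ∈ Finset.univ.erase j, β i :=
        Finset.sum_congr rfl fun i hi => hγi i (Finset.ne_of_mem_erase hi)
      omega
    rw [ih γ (fun i => (hγle i).trans (hβ i)) (fun i m h1 h2 => hzero i m h1 (h2.trans (hγle i)))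
      hsum]
    have hC := hf γ fun i => (hγle i).trans (hβ i)
    have hC' := (hf β hβ).1
    have hD : mixedDeriv f β = partialDeriv j (mixedDeriv f γ) := by
      conv_lhs => rw [hβγ]
      exact mixedDeriv_update f γ j hγ0
    rw [hD] at hC'
    have hlt : γ j < α := by have := hβ j; omega
    rw [setIntegral_mul_prod_eq_neg_partialDeriv j hC.1 (hC.2 j hlt hγ0) hC'
      (fun i => (hφ i).iterate_prim (γ i)), abs_neg, hD]
    · congr 2
      funext x
      congr 1
      refine Finset.prod_congr rfl fun i _ => ?_
      by_cases hi : i = j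
      · subst hi
        rw [Function.update_self, ← hγj, Function.iterate_succ_apply']
      · rw [Function.update_of_ne hi, hγi i hi]
    · rw [← Function.iterate_succ_apply' prim]
      exact hzero j _ (by omega) (by omega)

/-! ### Grid partitions of the cube -/

section Grid

variable {ι : Type*} [Fintype ι] [DecidableEq ι]

lemma le_of_forall_lt_succ {N : ℕ} {p : ℕ → ℝ} (hp : ∀ i < N, p i < p (i + 1)) {i i' : ℕ}
    (h : i ≤ i') (h' : i' ≤ N) : p i ≤ p i' := by
  induction i', h using Nat.le_induction with
  | base => exact le_rfl
  | succ n _ ih => exact (ih (by omega)).trans (hp n (by omega)).le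

lemma eq_of_mem_Ico_of_mem_Ico {N : ℕ} {p : ℕ → ℝ} (hp : ∀ i < N, p i < p (i + 1)) {i i' : ℕ}
    (hi : i < N) (hi' : i' < N) {x : ℝ} (h : x ∈ Set.Ico (p i) (p (i + 1)))
    (h' : x ∈ Set.Ico (p i') (p (i' + 1))) : i = i' := by
  by_contra hne
  rcases Nat.lt_or_gt_of_ne hne with hlt | hlt
  · have := le_of_forall_lt_succ hp (show i + 1 ≤ i' from hlt) hi'.le
    linarith [h.2, h'.1]
  · have := le_of_forall_lt_succ hp (show i' + 1 ≤ i from hlt) hi.le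
    linarith [h.1, h'.2]

lemma exists_mem_Ico_of_lt {p : ℕ → ℝ} {x : ℝ} (h0 : p 0 ≤ x) {N : ℕ} (h : x < p N) :
    ∃ i < N, x ∈ Set.Ico (p i) (p (i + 1)) := by
  induction N with
  | zero => linarith
  | succ N ih =>
    rcases lt_or_ge x (p N) with h1 | h1
    · obtain ⟨i, hi, hx⟩ := ih h1
      exact ⟨i, by omega, hx⟩
    · exact ⟨N, by omega, h1, h⟩

/-- The lower and upper corner of the cell with index `i` in the grid with breakpoints `p`. -/
def gridCell (p : ι → ℕ → ℝ) (i : ι → ℕ) : (ι → ℝ) × (ι → ℝ) :=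
  (fun j => p j (i j), fun j => p j (i j + 1))

lemma gridCell_eq_of_mem {N : ι → ℕ} {p : ι → ℕ → ℝ} (hp : ∀ j, ∀ i < N j, p j i < p j (i + 1))
    {i i' : ι → ℕ} (hi : i ∈ Fintype.piFinset fun j => Finset.range (N j))
    (hi' : i' ∈ Fintype.piFinset fun j => Finset.range (N j)) {x : ι → ℝ}
    (hx : x ∈ box (gridCell p i).1 (gridCell p i).2)
    (hx' : x ∈ box (gridCell p i').1 (gridCell p i').2) : i = i' := by
  simp only [Fintype.mem_piFinset, Finset.mem_range] at hi hi'
  exact funext fun j => eq_of_mem_Ico_of_mem_Ico (hp j) (hi j) (hi' j) (hx j) (hx' j)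

lemma left_mem_box {N : ι → ℕ} {p : ι → ℕ → ℝ} (hp : ∀ j, ∀ i < N j, p j i < p j (i + 1))
    {i : ι → ℕ} (hi : i ∈ Fintype.piFinset fun j => Finset.range (N j)) :
    (gridCell p i).1 ∈ box (gridCell p i).1 (gridCell p i).2 := by
  simp only [Fintype.mem_piFinset, Finset.mem_range] at hi
  exact fun j => ⟨le_rfl, hp j _ (hi j)⟩

lemma gridCell_injOn {N : ι → ℕ} {p : ι → ℕ → ℝ} (hp : ∀ j, ∀ i < N j, p j i < p j (i + 1)) :
    Set.InjOn (gridCell p) (Fintype.piFinset fun j => Finset.range (N j) : Finset (ι → ℕ)) := by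
  intro i hi i' hi' h
  refine gridCell_eq_of_mem hp hi hi' (left_mem_box hp hi) ?_
  rw [← h]
  exact left_mem_box hp hi

lemma isBoxPartition_grid {N : ι → ℕ} {p : ι → ℕ → ℝ}
    (hp : ∀ j, ∀ i < N j, p j i < p j (i + 1)) (h0 : ∀ j, p j 0 = 0) (h1 : ∀ j, p j (N j) = 1) :
    IsBoxPartition ((Fintype.piFinset fun j => Finset.range (N j)).image (gridCell p)) := by
  refine ⟨?_, ?_, ?_⟩
  · intro J hJ j
    obtain ⟨i, hi, rfl⟩ := Finset.mem_image.1 hJ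
    simp only [Fintype.mem_piFinset, Finset.mem_range] at hi
    exact hp j _ (hi j)
  · intro J hJ J' hJ' hne
    obtain ⟨i, hi, rfl⟩ := Finset.mem_image.1 hJ
    obtain ⟨i', hi', rfl⟩ := Finset.mem_image.1 hJ'
    rw [Set.disjoint_left]
    intro x hx hx'
    exact hne (by rw [gridCell_eq_of_mem hp hi hi' hx hx'])
  · ext x
    simp only [Set.mem_iUnion, Finset.mem_image, exists_prop]
    constructor
    · rintro ⟨J, ⟨i, hi, rfl⟩, hx⟩ j
      simp only [Fintype.mem_piFinset, Finset.mem_range] at hi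
      have a1 := le_of_forall_lt_succ (hp j) (Nat.zero_le (i j)) (hi j).le
      have a2 := le_of_forall_lt_succ (hp j) (show i j + 1 ≤ N j from hi j) le_rfl
      rw [h0] at a1
      rw [h1] at a2
      exact ⟨a1.trans (hx j).1, (hx j).2.trans_le a2⟩
    · intro hx
      have : ∀ j, ∃ i < N j, x j ∈ Set.Ico (p j i) (p j (i + 1)) := fun j =>
        exists_mem_Ico_of_lt (by rw [h0]; exact (hx j).1) (by rw [h1]; exact (hx j).2)
      choose i hi hxi using this
      exact ⟨_, ⟨i, by simpa using hi, rfl⟩, hxi⟩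

lemma sum_boxDelta_sq_le {lam v : ℝ} (hv0 : 0 ≤ v) {G : (ι → ℝ) → ℝ}
    (hv : vitaliVar lam G ≤ ENNReal.ofReal v) {P Q : Finset ((ι → ℝ) × (ι → ℝ))}
    (hP : IsBoxPartition P) (hQ : Q ⊆ P) :
    ∑ J ∈ Q, boxVol J.1 J.2 * |boxDelta G J.1 J.2 / boxVol J.1 J.2 ^ lam| ^ 2 ≤ v ^ 2 := by
  have hnn : ∀ J ∈ P, 0 ≤ boxVol J.1 J.2 * |boxDelta G J.1 J.2 / boxVol J.1 J.2 ^ lam| ^ 2 :=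
    fun J hJ => mul_nonneg (Finset.prod_nonneg fun j _ => by linarith [hP.lt J hJ j])
      (by positivity)
  refine (Finset.sum_le_sum_of_subset_of_nonneg hQ fun J hJ _ => hnn J hJ).trans ?_
  have h1 : (∑ J ∈ P, ENNReal.ofReal
      (boxVol J.1 J.2 * |boxDelta G J.1 J.2 / boxVol J.1 J.2 ^ lam| ^ 2)) ^ (1 / 2 : ℝ) ≤
      ENNReal.ofReal v := le_trans (le_iSup₂ (f := fun P (_ : IsBoxPartition P) =>
        (∑ J ∈ P, ENNReal.ofReal
      (boxVol J.1 J.2 * |boxDelta G J.1 J.2 / boxVol J.1 J.2 ^ lam| ^ 2)) ^ (1 / 2 : ℝ)) P hP) hv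
  rw [one_div, ENNReal.rpow_inv_le_iff (by norm_num), ← ENNReal.ofReal_sum_of_nonneg hnn,
    ENNReal.ofReal_rpow_of_nonneg hv0 (by norm_num), ENNReal.ofReal_le_ofReal_iff (by positivity)]
    at h1
  simpa using h1

/-- The fractional variation controls the sum of squared differences over the odd cells of a
dyadic grid shifted by `t`. -/
lemma sum_shifted_boxDelta_sq_le {lam v : ℝ} (hv0 : 0 ≤ v) {G : (ι → ℝ) → ℝ}
    (hv : vitaliVar lam G ≤ ENNReal.ofReal v) {n : ι → ℕ} {h t : ι → ℝ}
    (hh : ∀ j, ((2 * n j : ℕ) : ℝ) * h j = 1) (ht : ∀ j, t j ∈ Set.Ioo 0 (h j)) :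
    (∏ j, h j) * ∑ m ∈ Fintype.piFinset fun j => Finset.range (n j),
      boxDelta G (fun j => 2 * m j * h j + t j) (fun j => (2 * m j + 1) * h j + t j) ^ 2 ≤
      ((∏ j, h j) ^ lam) ^ 2 * v ^ 2 := by
  -- The shifted cells are completed to a partition by two strips, which are nonempty as
  -- `0 < t j < h j`.
  set p : ι → ℕ → ℝ := fun j i =>
    if i = 0 then 0 else if i ≤ 2 * n j then ((i - 1 : ℕ) : ℝ) * h j + t j else 1 with hpdef
  have hpos : ∀ j, 0 < h j := fun j => (ht j).1.trans (ht j).2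
  have hp : ∀ j, ∀ i < 2 * n j + 1, p j i < p j (i + 1) := by
    intro j i hi
    have hn : 1 ≤ n j := by
      by_contra hc
      have : n j = 0 := by omega
      have := hh j
      simp_all
    rcases Nat.eq_zero_or_pos i with rfl | hi0
    · have : (0 + 1 : ℕ) ≤ 2 * n j := by omega
      simp only [hpdef, if_true, if_neg (Nat.succ_ne_zero 0), if_pos this]
      simpa using (ht j).1
    · have hi1 : i ≤ 2 * n j := by omega
      simp only [hpdef, if_neg hi0.ne', if_neg (Nat.succ_ne_zero i), if_pos hi1]
      obtain ⟨q, rfl⟩ : ∃ q, i = q + 1 := ⟨i - 1, by omega⟩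
      split_ifs with h2
      · simp only [Nat.add_sub_cancel]
        push_cast
        nlinarith [hpos j]
      · have hq : 2 * n j = q + 1 := by omega
        have := hh j
        rw [hq] at this
        simp only [Nat.add_sub_cancel]
        push_cast at this
        nlinarith [(ht j).2]
  have hpart := isBoxPartition_grid (N := fun j => 2 * n j + 1) hp (fun j => by simp [hpdef])
    (fun j => by simp [hpdef])
  set odd : (ι → ℕ) → ι → ℕ := fun m j => 2 * m j + 1 with hodd
  have hodd_inj : Function.Injective odd := fun m m' h => funext fun j => by
    have := congrFun h j
    simp only [hodd] at this
    omega
  have hsub : ((Fintype.piFinset fun j => Finset.range (n j)).image odd).image (gridCell p) ⊆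
      (Fintype.piFinset fun j => Finset.range (2 * n j + 1)).image (gridCell p) := by
    refine Finset.image_subset_image ?_
    intro i hi
    obtain ⟨m, hm, rfl⟩ := Finset.mem_image.1 hi
    simp only [Fintype.mem_piFinset, Finset.mem_range, hodd] at hm ⊢
    intro j; have := hm j; omega
  have key := sum_boxDelta_sq_le hv0 hv hpart hsub
  rw [Finset.sum_image, Finset.sum_image hodd_inj.injOn] at key
  · have hcell : ∀ m ∈ Fintype.piFinset fun j => Finset.range (n j), gridCell p (odd m) =
        (fun j => 2 * m j * h j + t j, fun j => (2 * m j + 1) * h j + t j) := by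
      intro m hm
      simp only [Fintype.mem_piFinset, Finset.mem_range] at hm
      refine Prod.ext (funext fun j => ?_) (funext fun j => ?_)
      · have h2 : 2 * m j + 1 ≤ 2 * n j := by have := hm j; omega
        simp only [gridCell, hodd, hpdef, if_neg (Nat.succ_ne_zero _), if_pos h2]
        simp
      · have h2 : 2 * m j + 1 + 1 ≤ 2 * n j := by have := hm j; omega
        simp only [gridCell, hodd, hpdef, if_neg (Nat.succ_ne_zero _), if_pos h2]
        simp
    have hT : 0 < ∏ j, h j := Finset.prod_pos fun j _ => hpos j
    have hvol : ∀ m : ι → ℕ, boxVol (fun j => 2 * m j * h j + t j)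
        (fun j => (2 * m j + 1) * h j + t j) = ∏ j, h j := fun m =>
      Finset.prod_congr rfl fun j _ => by ring
    rw [Finset.sum_congr rfl fun m hm => by rw [hcell m hm, hvol m]] at key
    simp only [abs_div, div_pow, sq_abs] at key
    rw [← Finset.mul_sum, ← Finset.sum_div] at key
    have hTl : 0 < |(∏ j, h j) ^ lam| ^ 2 := by
      have := Real.rpow_pos_of_pos hT lam
      positivity
    rw [mul_div_assoc', div_le_iff₀ (by simpa using hTl), mul_comm (v ^ 2)] at key
    simpa using key
  · refine (gridCell_injOn hp).mono ?_
    intro i hi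
    obtain ⟨m, hm, rfl⟩ := Finset.mem_image.1 (Finset.mem_coe.1 hi)
    simp only [Finset.mem_coe, Fintype.mem_piFinset, Finset.mem_range, hodd] at hm ⊢
    intro j; have := hm j; omega

lemma box_eq_pi {κ : Type*} (d e : κ → ℝ) :
    box d e = Set.pi Set.univ fun j => Set.Ico (d j) (e j) := by
  ext x; simp [box]

lemma measurableSet_box {κ : Type*} [Countable κ] (d e : κ → ℝ) : MeasurableSet (box d e) := by
  rw [box_eq_pi]
  exact MeasurableSet.univ_pi fun _ => measurableSet_Ico

/-- Integration over the cube by summing over the translates of a cell that tiles it. -/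
lemma setIntegral_unitCube_eq_sum {n : ι → ℕ} {h : ι → ℝ} (hh : ∀ j, (n j : ℝ) * h j = 1)
    {H : (ι → ℝ) → ℝ} (hH : IntegrableOn H (unitCube ι)) :
    ∫ x in unitCube ι, H x = ∫ t in box 0 h, ∑ i ∈ Fintype.piFinset fun j => Finset.range (n j),
      H (fun j => i j * h j + t j) := by
  have hpos : ∀ j, 0 < h j := fun j => by
    by_contra hc
    have := hh j
    have h2 : (n j : ℝ) * h j ≤ 0 := mul_nonpos_of_nonneg_of_nonpos (by positivity) (not_lt.1 hc)
    linarith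
  set p : ι → ℕ → ℝ := fun j i => i * h j with hpdef
  have hp : ∀ j, ∀ i < n j, p j i < p j (i + 1) := fun j i _ => by
    simp only [hpdef]; push_cast; nlinarith [hpos j]
  have hpart := isBoxPartition_grid (N := n) hp (fun j => by simp [hpdef]) (fun j => hh j)
  have hcube : unitCube ι =ᵐ[volume] box (fun _ => 0) (fun _ => 1) := by
    rw [box_eq_pi]
    exact (Measure.univ_pi_Ico_ae_eq_Icc (f := fun _ : ι => (0 : ℝ)) (g := fun _ => 1)).symm
  have hboxsub : ∀ i ∈ Fintype.piFinset fun j => Finset.range (n j),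
      box (gridCell p i).1 (gridCell p i).2 ⊆ box (fun _ => 0) (fun _ => 1) := by
    intro i hi
    rw [← hpart.cover]
    exact Set.subset_biUnion_of_mem (u := fun J : (ι → ℝ) × (ι → ℝ) => box J.1 J.2)
      (Finset.mem_coe.2 (Finset.mem_image_of_mem _ hi))
  have hint : ∀ i ∈ Fintype.piFinset fun j => Finset.range (n j),
      IntegrableOn H (box (gridCell p i).1 (gridCell p i).2) := fun i hi =>
    (hH.congr_set_ae hcube.symm).mono_set (hboxsub i hi)
  have hcover : box (fun _ => 0) (fun _ => 1) = ⋃ i ∈ Fintype.piFinset fun j => Finset.range (n j),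
      box (gridCell p i).1 (gridCell p i).2 := by
    rw [← hpart.cover, Finset.set_biUnion_finset_image]
  have hshift : ∀ i : ι → ℕ, box (0 : ι → ℝ) h = (fun t : ι → ℝ => t + fun j => (i j : ℝ) * h j) ⁻¹'
      box (gridCell p i).1 (gridCell p i).2 := by
    intro i
    ext t
    simp only [box, gridCell, hpdef, Set.mem_ofPred_eq, Set.mem_preimage, Set.mem_Ico,
      Pi.add_apply, Pi.zero_apply]
    refine forall_congr' fun j => ?_
    push_cast
    constructor <;> rintro ⟨h1, h2⟩ <;> constructor <;> linarith
  have hmp : ∀ i : ι → ℕ, MeasurePreserving (fun t : ι → ℝ => t + fun j => (i j : ℝ) * h j)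
      volume volume := fun i => measurePreserving_add_right _ _
  have hemb : ∀ i : ι → ℕ, MeasurableEmbedding (fun t : ι → ℝ => t + fun j => (i j : ℝ) * h j) :=
    fun i => (MeasurableEquiv.addRight _).measurableEmbedding
  have harg : ∀ (i : ι → ℕ) (t : ι → ℝ),
      (fun j => (i j : ℝ) * h j + t j) = t + fun j => (i j : ℝ) * h j :=
    fun i t => funext fun j => add_comm _ _
  rw [setIntegral_congr_set hcube, hcover, integral_biUnion_finset, integral_finsetSum]
  · refine Finset.sum_congr rfl fun i _ => ?_
    rw [← (hmp i).setIntegral_preimage_emb (hemb i), ← hshift i]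
    simp only [harg]
  · intro i hi
    have := ((hmp i).integrableOn_comp_preimage (hemb i)).2 (hint i hi)
    rw [← hshift i] at this
    simp only [harg]
    exact this
  · exact fun i _ => measurableSet_box _ _
  · intro i hi i' hi' hne
    exact hpart.disjoint _ (Finset.mem_image_of_mem _ hi) _ (Finset.mem_image_of_mem _ hi')
      fun he => hne (gridCell_injOn hp hi hi' he)
  · exact hint

lemma sum_piFinset_range_two_mul (n : ι → ℕ) (F : (ι → ℕ) → ℝ) :
    ∑ i ∈ Fintype.piFinset fun j => Finset.range (2 * n j), F i =
      ∑ m ∈ Fintype.piFinset fun j => Finset.range (n j), ∑ v : Finset ι,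
        F fun j => if j ∈ v then 2 * m j else 2 * m j + 1 := by
  rw [← Finset.sum_product']
  symm
  refine Finset.sum_bij' (fun q _ j => if j ∈ q.2 then 2 * q.1 j else 2 * q.1 j + 1)
    (fun i _ => (fun j => i j / 2, Finset.univ.filter fun j => i j % 2 = 0)) ?_ ?_ ?_ ?_ ?_
  · rintro ⟨m, v⟩ h
    simp only [Finset.mem_product, Fintype.mem_piFinset, Finset.mem_range, Finset.mem_univ,
      and_true] at h ⊢
    intro j; have := h j; split_ifs <;> omega
  · intro i h
    simp only [Finset.mem_product, Fintype.mem_piFinset, Finset.mem_range, Finset.mem_univ,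
      and_true] at h ⊢
    intro j; have := h j; omega
  · rintro ⟨m, v⟩ _
    refine Prod.ext (funext fun j => ?_) (Finset.ext fun j => ?_)
    · simp only; split_ifs <;> omega
    · simp only [Finset.mem_filter, Finset.mem_univ, true_and]; split_ifs with hj <;> simp [hj]
  · intro i _
    funext j
    simp only [Finset.mem_filter, Finset.mem_univ, true_and]; split_ifs <;> omega
  · intro q _; rfl

/-! ### Square sums over a block of low-frequency factors -/

/-- Orthogonality: two distinct grid points are separated by one of the Rademacher functions, which
makes a factor of `∏ (1 + rad a x * rad a y)` vanish. -/
lemma sum_walS_mul_walS {n m m' : ℕ} (hm : m < 2 ^ n) (hm' : m' < 2 ^ n) :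
    ∑ S ∈ (Finset.Ico 1 (n + 1)).powerset,
      walS S (m * ((2 : ℝ) ^ n)⁻¹) * walS S (m' * ((2 : ℝ) ^ n)⁻¹) =
      if m = m' then 2 ^ n else 0 := by
  simp only [walS, ← Finset.prod_mul_distrib]
  rw [← Finset.prod_one_add]
  split_ifs with h
  · subst h
    simp only [rad_mul_self]
    norm_num
  · have hfl : ∀ q : ℕ, ⌊(2 : ℝ) ^ n * (q * ((2 : ℝ) ^ n)⁻¹)⌋ = q := by
      intro q
      have : (2 : ℝ) ^ n * (q * ((2 : ℝ) ^ n)⁻¹) = q := by field_simp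
      rw [this, Int.floor_natCast]
    have hf0 : ∀ q : ℕ, q < 2 ^ n → ⌊(q * ((2 : ℝ) ^ n)⁻¹ : ℝ)⌋ = 0 := by
      intro q hq
      rw [Int.floor_eq_iff]
      refine ⟨by simp, ?_⟩
      rw [← div_eq_mul_inv, div_lt_iff₀ (by positivity)]
      simpa using (by exact_mod_cast hq : (q : ℝ) < 2 ^ n)
    obtain ⟨a, ha1, ha2, hne⟩ : ∃ a, 1 ≤ a ∧ a ≤ n ∧
        rad a (m * ((2 : ℝ) ^ n)⁻¹) ≠ rad a (m' * ((2 : ℝ) ^ n)⁻¹) := by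
      by_contra hc
      push Not at hc
      have := floor_two_pow_eq_of_rad_eq ((hf0 m hm).trans (hf0 m' hm').symm) hc
      rw [hfl, hfl] at this
      exact h (by exact_mod_cast this)
    refine Finset.prod_eq_zero (Finset.mem_Ico.2 ⟨ha1, by omega⟩) ?_
    unfold rad at hne ⊢
    split_ifs at hne ⊢ <;> simp_all

/-- Parseval's identity for the Walsh functions on a finite dyadic grid. -/
lemma sum_sq_sum_walS (n : ι → ℕ) (A : (ι → ℕ) → ℝ) :
    ∑ S ∈ Fintype.piFinset fun j => (Finset.Ico 1 (n j + 1)).powerset,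
      (∑ m ∈ Fintype.piFinset fun j => Finset.range (2 ^ n j),
        (∏ j, walS (S j) (m j * ((2 : ℝ) ^ n j)⁻¹)) * A m) ^ 2 =
    (∏ j, (2 : ℝ) ^ n j) *
      ∑ m ∈ Fintype.piFinset fun j => Finset.range (2 ^ n j), A m ^ 2 := by
  simp only [sq, Finset.sum_mul_sum]
  rw [Finset.sum_comm, Finset.mul_sum]
  refine Finset.sum_congr rfl fun m hm => ?_
  rw [Finset.sum_comm]
  have : ∀ m' ∈ Fintype.piFinset fun j => Finset.range (2 ^ n j),
      ∑ S ∈ Fintype.piFinset fun j => (Finset.Ico 1 (n j + 1)).powerset,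
        (∏ j, walS (S j) (m j * ((2 : ℝ) ^ n j)⁻¹)) * A m *
          ((∏ j, walS (S j) (m' j * ((2 : ℝ) ^ n j)⁻¹)) * A m') =
      if m' = m then (∏ j, (2 : ℝ) ^ n j) * (A m * A m') else 0 := by
    intro m' hm'
    simp only [Fintype.mem_piFinset, Finset.mem_range] at hm hm'
    have e : ∀ S : ι → Finset ℕ, (∏ j, walS (S j) (m j * ((2 : ℝ) ^ n j)⁻¹)) * A m *
          ((∏ j, walS (S j) (m' j * ((2 : ℝ) ^ n j)⁻¹)) * A m') =
        (∏ j, walS (S j) (m j * ((2 : ℝ) ^ n j)⁻¹) * walS (S j) (m' j * ((2 : ℝ) ^ n j)⁻¹)) *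
          (A m * A m') := fun S => by rw [Finset.prod_mul_distrib]; ring
    have hprod := Finset.prod_univ_sum (fun j => (Finset.Ico 1 (n j + 1)).powerset)
      fun j S => walS S (m j * ((2 : ℝ) ^ n j)⁻¹) * walS S (m' j * ((2 : ℝ) ^ n j)⁻¹)
    simp only [e]
    rw [← Finset.sum_mul, ← hprod,
      Finset.prod_congr rfl fun j _ => sum_walS_mul_walS (hm j) (hm' j)]
    split_ifs with h
    · subst h; simp
    · obtain ⟨j, hj⟩ := Function.ne_iff.1 h
      rw [Finset.prod_eq_zero (Finset.mem_univ j) (by rw [if_neg (Ne.symm hj)]), zero_mul]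
  rw [Finset.sum_congr rfl this, Finset.sum_ite_eq' _ m, if_pos hm]

lemma sq_setIntegral_le {X : Type*} [MeasurableSpace X] {μ : Measure X} {B : Set X}
    (hB : μ B ≠ ⊤) {F : X → ℝ} (hF : IntegrableOn F B μ)
    (hF2 : IntegrableOn (fun x => F x ^ 2) B μ) :
    (∫ x in B, F x ∂μ) ^ 2 ≤ μ.real B * ∫ x in B, F x ^ 2 ∂μ := by
  set A := ∫ x in B, F x ∂μ with hA
  set V := μ.real B with hV
  have hc : ∀ c : ℝ, IntegrableOn (fun _ => c) B μ := fun c => integrableOn_const hB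
  have h : 0 ≤ ∫ x in B, (V * F x - A) ^ 2 ∂μ := integral_nonneg fun x => sq_nonneg _
  have e : ∫ x in B, (V * F x - A) ^ 2 ∂μ = V ^ 2 * (∫ x in B, F x ^ 2 ∂μ) - V * A ^ 2 := by
    have : ∀ x, (V * F x - A) ^ 2 = V ^ 2 * F x ^ 2 - 2 * V * A * F x + A ^ 2 := fun x => by ring
    have h2 : IntegrableOn (fun x => V ^ 2 * F x ^ 2) B μ := hF2.const_mul _
    have h1 : IntegrableOn (fun x => 2 * V * A * F x) B μ := hF.const_mul _
    have h3 : IntegrableOn (fun x => V ^ 2 * F x ^ 2 - 2 * V * A * F x) B μ := h2.sub h1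
    simp only [this]
    rw [integral_add h3 (hc _), integral_sub h2 h1, integral_const_mul, integral_const_mul,
      setIntegral_const, ← hA, smul_eq_mul, ← hV]
    ring
  rw [e] at h
  have hV0 : 0 ≤ V := measureReal_nonneg
  rcases hV0.eq_or_lt with h0 | h0
  · have : A = 0 := by
      rw [hA]
      apply setIntegral_measure_zero
      rcases (ENNReal.toReal_eq_zero_iff _).1 h0.symm with h | h
      · exact h
      · exact absurd h hB
    rw [this, ← h0]; simp
  · nlinarith

end Grid

section Block

variable {ι : Type*} [Fintype ι] [DecidableEq ι]

lemma two_pow_eq_two_mul {l : ℕ} (hl : 1 ≤ l) : (2 : ℕ) ^ l = 2 * 2 ^ (l - 1) := by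
  obtain ⟨m, rfl⟩ := Nat.exists_eq_add_of_le hl
  rw [Nat.add_sub_cancel_left, pow_add, pow_one]

lemma floor_half_cell {l m e : ℕ} (hl : 1 ≤ l) (he : e < 2) {t : ℝ} (h0 : 0 ≤ t)
    (h1 : t < ((2 : ℝ) ^ l)⁻¹) :
    ⌊(2 : ℝ) ^ (l - 1) * ((2 * m + e : ℕ) * ((2 : ℝ) ^ l)⁻¹ + t)⌋ = m := by
  obtain ⟨n, rfl⟩ := Nat.exists_eq_add_of_le hl
  rw [Nat.add_sub_cancel_left, Int.floor_eq_iff]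
  have hp : (0 : ℝ) < 2 ^ n := by positivity
  have hq : (2 : ℝ) ^ n * ((2 : ℝ) ^ (1 + n))⁻¹ = 1 / 2 := by rw [pow_add]; field_simp
  have ht : (2 : ℝ) ^ n * t < 1 / 2 := by rw [← hq]; exact mul_lt_mul_of_pos_left h1 hp
  have ht0 : 0 ≤ (2 : ℝ) ^ n * t := by positivity
  have hexp : (2 : ℝ) ^ n * ((2 * m + e : ℕ) * ((2 : ℝ) ^ (1 + n))⁻¹ + t) =
      m + e * (1 / 2) + 2 ^ n * t := by
    push_cast
    linear_combination ((2 * m + e : ℝ)) * hq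
  have he' : (e : ℝ) ≤ 1 := by exact_mod_cast Nat.lt_succ_iff.1 he
  rw [hexp]
  constructor
  · push_cast; linarith [show (0 : ℝ) ≤ e from by positivity]
  · push_cast; linarith

lemma rad_half_cell (l m e : ℕ) (he : e < 2) {t : ℝ} (h0 : 0 ≤ t)
    (h1 : t < ((2 : ℝ) ^ l)⁻¹) :
    rad l ((2 * m + e : ℕ) * ((2 : ℝ) ^ l)⁻¹ + t) = if e = 0 then 1 else -1 := by
  have hp := (rad_periodic l).nat_mul m
  interval_cases e
  · have e1 : ((2 * m + 0 : ℕ) : ℝ) * ((2 : ℝ) ^ l)⁻¹ + t = t + m * (2 * ((2 : ℝ) ^ l)⁻¹) := by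
      push_cast; ring
    rw [e1, hp, rad_eq_one h0 h1, if_pos rfl]
  · have e1 : ((2 * m + 1 : ℕ) : ℝ) * ((2 : ℝ) ^ l)⁻¹ + t =
        t + ((2 : ℝ) ^ l)⁻¹ + m * (2 * ((2 : ℝ) ^ l)⁻¹) := by
      push_cast; ring
    rw [e1, hp, rad_add_half, rad_eq_one h0 h1, if_neg (by norm_num)]

/-- On a cell of the grid of mesh `2^{1-l_j}`, the Rademacher factors of level `l_j` turn the sum
over the half cells into the alternating sum over the vertices of a box. -/
lemma sum_halfCells_eq_boxDelta {l : ι → ℕ} (hl : ∀ j, 1 ≤ l j) (G : (ι → ℝ) → ℝ) {W : ι → ℝ → ℝ}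
    (hWp : ∀ j, Function.Periodic (W j) ((2 : ℝ) ^ l j)⁻¹) {S : ι → Finset ℕ}
    (hS : ∀ j, ∀ a ∈ S j, a < l j) (m : ι → ℕ) {t : ι → ℝ}
    (ht : ∀ j, t j ∈ Set.Ico 0 ((2 : ℝ) ^ l j)⁻¹) :
    ∑ v : Finset ι, (fun y : ι → ℝ => G y * ∏ j, (W j (y j) * rad (l j) (y j) * walS (S j) (y j)))
      (fun j => ((if j ∈ v then 2 * m j else 2 * m j + 1 : ℕ) : ℝ) * ((2 : ℝ) ^ l j)⁻¹ + t j) =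
    (∏ j, W j (t j)) * ((∏ j, walS (S j) (m j * ((2 : ℝ) ^ (l j - 1))⁻¹)) *
      boxDelta G (fun j => 2 * m j * ((2 : ℝ) ^ l j)⁻¹ + t j)
        (fun j => (2 * m j + 1) * ((2 : ℝ) ^ l j)⁻¹ + t j)) := by
  unfold boxDelta
  rw [Finset.mul_sum, Finset.mul_sum]
  refine Finset.sum_congr rfl fun v _ => ?_
  have hfac : ∀ j, ∀ e < 2, W j ((2 * m j + e : ℕ) * ((2 : ℝ) ^ l j)⁻¹ + t j) *
      rad (l j) ((2 * m j + e : ℕ) * ((2 : ℝ) ^ l j)⁻¹ + t j) *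
      walS (S j) ((2 * m j + e : ℕ) * ((2 : ℝ) ^ l j)⁻¹ + t j) =
      W j (t j) * (if e = 0 then 1 else -1) * walS (S j) (m j * ((2 : ℝ) ^ (l j - 1))⁻¹) := by
    intro j e he
    rw [rad_half_cell (l j) (m j) e he (ht j).1 (ht j).2, add_comm _ (t j),
      (hWp j).nat_mul (2 * m j + e) (t j), add_comm (t j)]
    congr 1
    refine walS_of_floor_eq (n := l j - 1) (fun a ha => by have := hS j a ha; omega) ?_
    rw [floor_half_cell (hl j) he (ht j).1 (ht j).2]
    have : (2 : ℝ) ^ (l j - 1) * (m j * ((2 : ℝ) ^ (l j - 1))⁻¹) = m j := by field_simp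
    rw [this, Int.floor_natCast]
  have hprod : ∏ j, (W j (((if j ∈ v then 2 * m j else 2 * m j + 1 : ℕ) : ℝ) *
        ((2 : ℝ) ^ l j)⁻¹ + t j) *
      rad (l j) (((if j ∈ v then 2 * m j else 2 * m j + 1 : ℕ) : ℝ) * ((2 : ℝ) ^ l j)⁻¹ + t j) *
      walS (S j) (((if j ∈ v then 2 * m j else 2 * m j + 1 : ℕ) : ℝ) * ((2 : ℝ) ^ l j)⁻¹ + t j)) =
      ∏ j, (W j (t j) * (if j ∈ v then 1 else -1) * walS (S j)
        (m j * ((2 : ℝ) ^ (l j - 1))⁻¹)) := by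
    refine Finset.prod_congr rfl fun j _ => ?_
    by_cases hj : j ∈ v
    · have := hfac j 0 (by norm_num)
      simpa [hj] using this
    · have := hfac j 1 (by norm_num)
      simpa [hj] using this
  have hsign : ∏ j : ι, (if j ∈ v then (1 : ℝ) else -1) =
      (-1) ^ (Fintype.card ι - v.card) := by
    rw [Finset.prod_ite, Finset.prod_const_one, one_mul, Finset.prod_const, ← Finset.card_compl]
    congr 2
    ext j; simp
  have harg : (fun j => ((if j ∈ v then 2 * m j else 2 * m j + 1 : ℕ) : ℝ) *
      ((2 : ℝ) ^ l j)⁻¹ + t j) = fun j => if j ∈ v then 2 * m j * ((2 : ℝ) ^ l j)⁻¹ + t j else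
        (2 * m j + 1) * ((2 : ℝ) ^ l j)⁻¹ + t j := by
    funext j
    split_ifs <;> push_cast <;> rfl
  simp only
  rw [hprod, harg, Finset.prod_mul_distrib, Finset.prod_mul_distrib, hsign]
  ring

lemma continuousOn_boxDelta_shift {l : ι → ℕ} {G : (ι → ℝ) → ℝ} (hG : ContinuousOn G (unitCube ι))
    {n : ι → ℕ} (hn : ∀ j, (2 : ℝ) ^ l j = 2 * n j) {m : ι → ℕ} (hm : ∀ j, m j < n j) :
    ContinuousOn (fun t : ι → ℝ => boxDelta G (fun j => 2 * m j * ((2 : ℝ) ^ l j)⁻¹ + t j)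
        (fun j => (2 * m j + 1) * ((2 : ℝ) ^ l j)⁻¹ + t j))
      (Set.Icc 0 fun j => ((2 : ℝ) ^ l j)⁻¹) := by
  unfold boxDelta
  refine continuousOn_finsetSum _ fun v _ => continuousOn_const.mul ?_
  refine hG.comp (Continuous.continuousOn ?_) ?_
  · refine continuous_pi fun j => ?_
    split_ifs <;> fun_prop
  · intro t ht
    rw [mem_unitCube]
    intro j
    have h0 : 0 ≤ t j := ht.1 j
    have h1 : t j ≤ ((2 : ℝ) ^ l j)⁻¹ := ht.2 j
    have hm' : (m j : ℝ) + 1 ≤ n j := by exact_mod_cast hm j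
    have hq : (0 : ℝ) < ((2 : ℝ) ^ l j)⁻¹ := by positivity
    have hone : 2 * (n j : ℝ) * ((2 : ℝ) ^ l j)⁻¹ = 1 := by
      rw [← hn j]; exact mul_inv_cancel₀ (by positivity)
    have hlast : (2 * (m j : ℝ) + 1) * ((2 : ℝ) ^ l j)⁻¹ + ((2 : ℝ) ^ l j)⁻¹ ≤ 1 := by
      rw [← hone]; nlinarith
    have hmq : 0 ≤ 2 * (m j : ℝ) * ((2 : ℝ) ^ l j)⁻¹ := by positivity
    dsimp only
    split_ifs
    · exact ⟨by linarith, by linarith⟩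
    · exact ⟨by linarith, by linarith⟩

/-- The square sum of the integrals against Walsh functions whose finest digits are `l_j`,
multiplied by weights that are periodic of half that scale, is controlled by the fractional
variation. -/
lemma sum_sq_setIntegral_walsh_le {lam v : ℝ} (hv0 : 0 ≤ v) {l : ι → ℕ} (hl : ∀ j, 1 ≤ l j)
    {G : (ι → ℝ) → ℝ} (hG : ContinuousOn G (unitCube ι))
    (hv : vitaliVar lam G ≤ ENNReal.ofReal v) {W : ι → ℝ → ℝ} (hW : ∀ j, Continuous (W j))
    (hWp : ∀ j, Function.Periodic (W j) ((2 : ℝ) ^ l j)⁻¹) {c : ι → ℝ}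
    (hc : ∀ j x, |W j x| ≤ c j) :
    ∑ S ∈ Fintype.piFinset fun j => (Finset.Ico 1 (l j)).powerset,
      (∫ y in unitCube ι, G y * ∏ j, (W j (y j) * rad (l j) (y j) * walS (S j) (y j))) ^ 2 ≤
      (∏ j, c j) ^ 2 * ((∏ j, ((2 : ℝ) ^ l j)⁻¹) ^ lam) ^ 2 * v ^ 2 := by
  set n : ι → ℕ := fun j => 2 ^ (l j - 1) with hndef
  set h : ι → ℝ := fun j => ((2 : ℝ) ^ l j)⁻¹ with hhdef
  have hn2 : ∀ j, (2 : ℕ) ^ l j = 2 * n j := fun j => two_pow_eq_two_mul (hl j)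
  have hn2' : ∀ j, (2 : ℝ) ^ l j = 2 * n j := fun j => by exact_mod_cast hn2 j
  have hpos : ∀ j, 0 < h j := fun j => by simp only [hhdef]; positivity
  have hh : ∀ j, ((2 * n j : ℕ) : ℝ) * h j = 1 := fun j => by
    push_cast
    rw [← hn2' j]; exact mul_inv_cancel₀ (by positivity)
  set T : ℝ := ∏ j, h j with hT
  have hTpos : 0 < T := Finset.prod_pos fun j _ => hpos j
  set M : Finset (ι → ℕ) := Fintype.piFinset fun j => Finset.range (n j) with hM
  set A : (ι → ℕ) → (ι → ℝ) → ℝ := fun m t =>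
    boxDelta G (fun j => 2 * m j * h j + t j) (fun j => (2 * m j + 1) * h j + t j) with hA
  set χ : (ι → Finset ℕ) → (ι → ℕ) → ℝ := fun S m =>
    ∏ j, walS (S j) (m j * ((2 : ℝ) ^ (l j - 1))⁻¹) with hχ
  set F : (ι → Finset ℕ) → (ι → ℝ) → ℝ := fun S t =>
    (∏ j, W j (t j)) * ∑ m ∈ M, χ S m * A m t with hF
  set Λ : Finset (ι → Finset ℕ) := Fintype.piFinset fun j => (Finset.Ico 1 (l j)).powerset with hΛ
  have hsubB : box 0 h ⊆ Set.Icc 0 h := by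
    intro t ht
    exact ⟨fun j => (ht j).1, fun j => (ht j).2.le⟩
  have hvolB : volume.real (box 0 h) = T := by
    rw [box_eq_pi, measureReal_def, Real.volume_pi_Ico]
    rw [ENNReal.toReal_prod]
    refine Finset.prod_congr rfl fun j _ => ?_
    rw [Pi.zero_apply, sub_zero, ENNReal.toReal_ofReal (hpos j).le]
  have hBfin : volume (box 0 h) ≠ ⊤ :=
    ((measure_mono hsubB).trans_lt (isCompact_Icc.measure_lt_top)).ne
  -- The Walsh integrals in terms of box differences.
  have hint : ∀ S ∈ Λ, ∫ y in unitCube ι, G y * ∏ j, (W j (y j) * rad (l j) (y j) *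
      walS (S j) (y j)) = ∫ t in box 0 h, F S t := by
    intro S hS
    rw [setIntegral_unitCube_eq_sum (n := fun j => 2 * n j) hh (integrableOn_mul_prod hG
      (φ := fun j x => W j x * rad (l j) x * walS (S j) x) fun j =>
      ((hW j).locBdd.mul (locBdd_rad _)).mul (locBdd_walS _))]
    refine setIntegral_congr_fun (measurableSet_box _ _) fun t ht => ?_
    have hS' : ∀ j, ∀ a ∈ S j, a < l j := fun j a ha =>
      (Finset.mem_Ico.1 (Finset.mem_powerset.1 (Fintype.mem_piFinset.1 hS j) ha)).2
    have e1 := sum_piFinset_range_two_mul n fun i => (fun y : ι → ℝ => G y *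
      ∏ j, (W j (y j) * rad (l j) (y j) * walS (S j) (y j))) fun j => (i j : ℝ) * h j + t j
    refine e1.trans ?_
    rw [hF]
    simp only
    rw [Finset.mul_sum]
    exact Finset.sum_congr rfl fun m _ => sum_halfCells_eq_boxDelta hl G hWp hS' m ht
  have hAc : ∀ m ∈ M, ContinuousOn (A m) (Set.Icc 0 h) := fun m hm =>
    continuousOn_boxDelta_shift hG hn2' fun j => by
      simpa using Fintype.mem_piFinset.1 hm j
  have hFc : ∀ S, ContinuousOn (F S) (Set.Icc 0 h) := fun S => by
    refine ContinuousOn.mul (Continuous.continuousOn ?_) ?_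
    · exact continuous_finsetProd _ fun j _ => (hW j).comp (continuous_apply j)
    · exact continuousOn_finsetSum _ fun m hm => continuousOn_const.mul (hAc m hm)
  have hFi : ∀ S, IntegrableOn (F S) (box 0 h) := fun S =>
    ((hFc S).integrableOn_compact isCompact_Icc).mono_set hsubB
  have hFi2 : ∀ S, IntegrableOn (fun t => F S t ^ 2) (box 0 h) := fun S =>
    (((hFc S).pow 2).integrableOn_compact isCompact_Icc).mono_set hsubB
  set K : ℝ := (∏ j, c j) ^ 2 * ((∏ j, (2 : ℝ) ^ (l j - 1)) * ((T ^ lam) ^ 2 * v ^ 2 / T)) with hK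
  have hparseval : ∀ t, ∑ S ∈ Λ, F S t ^ 2 =
      (∏ j, W j (t j)) ^ 2 * ((∏ j, (2 : ℝ) ^ (l j - 1)) * ∑ m ∈ M, A m t ^ 2) := by
    intro t
    have := sum_sq_sum_walS (fun j => l j - 1) fun m => A m t
    have hset : (fun j => (Finset.Ico 1 (l j - 1 + 1)).powerset) =
        fun j => (Finset.Ico 1 (l j)).powerset := by
      funext j
      rw [Nat.sub_add_cancel (hl j)]
    rw [hset] at this
    rw [← this, Finset.mul_sum]
    exact Finset.sum_congr rfl fun S _ => by rw [← mul_pow]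
  have hWc : ∀ t : ι → ℝ, (∏ j, W j (t j)) ^ 2 ≤ (∏ j, c j) ^ 2 := by
    intro t
    rw [← sq_abs (∏ j, W j (t j)), Finset.abs_prod]
    exact pow_le_pow_left₀ (Finset.prod_nonneg fun _ _ => abs_nonneg _)
      (Finset.prod_le_prod (fun _ _ => abs_nonneg _) fun j _ => hc j _) 2
  have hpt : ∀ t, (∀ j, t j ∈ Set.Ioo 0 (h j)) → ∑ S ∈ Λ, F S t ^ 2 ≤ K := by
    intro t ht
    rw [hparseval]
    have h1 := sum_shifted_boxDelta_sq_le hv0 hv hh ht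
    have h2 : ∑ m ∈ M, A m t ^ 2 ≤ (T ^ lam) ^ 2 * v ^ 2 / T := by
      rw [le_div_iff₀' hTpos]; exact h1
    exact mul_le_mul (hWc t) (mul_le_mul_of_nonneg_left h2 (by positivity))
      (by positivity) (by positivity)
  have hae : ∀ᵐ t ∂(volume.restrict (box 0 h)), ∑ S ∈ Λ, F S t ^ 2 ≤ K := by
    have e1 : box 0 h =ᵐ[volume] Set.pi Set.univ fun j => Set.Ioo ((0 : ι → ℝ) j) (h j) := by
      rw [box_eq_pi]
      exact Measure.univ_pi_Ico_ae_eq_Icc.trans Measure.univ_pi_Ioo_ae_eq_Icc.symm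
    rw [Measure.restrict_congr_set e1]
    filter_upwards [ae_restrict_mem (MeasurableSet.univ_pi fun _ => measurableSet_Ioo)] with t ht
    exact hpt t fun j => ht j (Set.mem_univ j)
  calc ∑ S ∈ Λ, (∫ y in unitCube ι, G y *
        ∏ j, (W j (y j) * rad (l j) (y j) * walS (S j) (y j))) ^ 2
      = ∑ S ∈ Λ, (∫ t in box 0 h, F S t) ^ 2 :=
        Finset.sum_congr rfl fun S hS => by rw [hint S hS]
    _ ≤ ∑ S ∈ Λ, T * ∫ t in box 0 h, F S t ^ 2 := by
        refine Finset.sum_le_sum fun S _ => ?_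
        rw [← hvolB]
        exact sq_setIntegral_le hBfin (hFi S) (hFi2 S)
    _ = T * ∫ t in box 0 h, ∑ S ∈ Λ, F S t ^ 2 := by
        rw [← Finset.mul_sum, integral_finsetSum _ fun S _ => hFi2 S]
    _ ≤ T * ∫ t in box 0 h, K := by
        refine mul_le_mul_of_nonneg_left ?_ hTpos.le
        exact integral_mono_ae (integrable_finsetSum _ fun S _ => hFi2 S) (integrableOn_const hBfin)
          hae
    _ = (T * ∏ j, (2 : ℝ) ^ (l j - 1)) * ((∏ j, c j) ^ 2 * (T ^ lam) ^ 2 * v ^ 2) := by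
        rw [setIntegral_const, hvolB, smul_eq_mul, hK]
        field_simp
    _ ≤ 1 * ((∏ j, c j) ^ 2 * (T ^ lam) ^ 2 * v ^ 2) := by
        refine mul_le_mul_of_nonneg_right ?_ (by positivity)
        rw [hT, ← Finset.prod_mul_distrib]
        refine Finset.prod_le_one (fun j _ => mul_nonneg (hpos j).le (by positivity)) fun j _ => ?_
        have := hh j
        simp only [hndef] at this
        push_cast at this
        nlinarith [mul_pos (hpos j) (show (0 : ℝ) < 2 ^ (l j - 1) by positivity)]
    _ = (∏ j, c j) ^ 2 * (T ^ lam) ^ 2 * v ^ 2 := one_mul _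

end Block

/-! ### Marginals -/

lemma glue_mem_unitCube {s : ℕ} {u : Finset (Fin s)} {y : {j // j ∈ u} → ℝ}
    {z : {j // j ∉ u} → ℝ} (hy : y ∈ unitCube _) (hz : z ∈ unitCube _) :
    glue u y z ∈ unitCube (Fin s) := by
  rw [mem_unitCube] at *
  intro j
  unfold glue
  split_ifs with h
  · exact hy ⟨j, h⟩
  · exact hz ⟨j, h⟩

lemma continuous_glue {s : ℕ} (u : Finset (Fin s)) :
    Continuous fun p : ({j // j ∈ u} → ℝ) × ({j // j ∉ u} → ℝ) => glue u p.1 p.2 := by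
  refine continuous_pi fun j => ?_
  unfold glue
  split_ifs <;> fun_prop

lemma glue_mem {s : ℕ} {u : Finset (Fin s)} (y : {j // j ∈ u} → ℝ)
    (z : {j // j ∉ u} → ℝ) (j : {j // j ∈ u}) : glue u y z j = y j := by
  simp [glue, j.2]

lemma glue_notMem {s : ℕ} {u : Finset (Fin s)} (y : {j // j ∈ u} → ℝ)
    (z : {j // j ∉ u} → ℝ) (j : {j // j ∉ u}) : glue u y z j = z j := by
  simp [glue, j.2]

/-- A function that is continuous on the cube is extended by clamping the coordinates, so that the
continuity of parametric integrals of globally continuous functions applies. -/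
lemma continuousOn_partialInt {s : ℕ} (u : Finset (Fin s)) {g : (Fin s → ℝ) → ℝ}
    (hg : ContinuousOn g (unitCube (Fin s))) : ContinuousOn (partialInt u g) (unitCube _) := by
  set clamp : (Fin s → ℝ) → (Fin s → ℝ) := fun x j => max 0 (min 1 (x j)) with hclamp
  have hcl : Continuous clamp := by fun_prop
  have hmem : ∀ x, clamp x ∈ unitCube (Fin s) := fun x => mem_unitCube.2 fun j =>
    ⟨le_max_left _ _, max_le zero_le_one (min_le_left _ _)⟩
  have hid : ∀ x ∈ unitCube (Fin s), clamp x = x := fun x hx => funext fun j => by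
    have := mem_unitCube.1 hx j
    simp only [hclamp, min_eq_right this.2, max_eq_right this.1]
  have hgc : Continuous fun x => g (clamp x) := hg.comp_continuous hcl hmem
  have hcont := continuous_parametric_integral_of_continuous (μ := volume)
    (f := fun (y : {j // j ∈ u} → ℝ) (z : {j // j ∉ u} → ℝ) => g (clamp (glue u y z)))
    (hgc.comp (continuous_glue u)) (isCompact_unitCube {j // j ∉ u})
  refine hcont.continuousOn.congr fun y hy => ?_
  refine setIntegral_congr_fun (measurableSet_unitCube _) fun z hz => ?_
  rw [hid _ (glue_mem_unitCube hy hz)]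

lemma prod_mem_mul_prod_notMem {κ : Type*} [Fintype κ] [DecidableEq κ] (u : Finset κ)
    (g : κ → ℝ) : (∏ j : {j // j ∈ u}, g j) * ∏ j : {j // j ∉ u}, g j = ∏ j, g j := by
  convert Fintype.prod_subtype_mul_prod_subtype (· ∈ u) g

lemma setIntegral_unitCube_eq_partialInt {s : ℕ} (u : Finset (Fin s)) {g : (Fin s → ℝ) → ℝ}
    (hg : ContinuousOn g (unitCube (Fin s))) {φ : Fin s → ℝ → ℝ} (hφ : ∀ j, LocBdd (φ j)) :
    ∫ x in unitCube (Fin s), g x * ∏ j, φ j (x j) =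
      ∫ y in unitCube {j // j ∈ u},
        partialInt u (fun x => g x * ∏ j : {j // j ∉ u}, φ j (x j)) y *
          ∏ j : {j // j ∈ u}, φ j (y j) := by
  set e : (Fin s → ℝ) ≃ᵐ ({j // j ∈ u} → ℝ) × ({j // j ∉ u} → ℝ) :=
    MeasurableEquiv.piEquivPiSubtypeProd (fun _ : Fin s => ℝ) (· ∈ u) with he
  have hmp : MeasurePreserving e.symm (volume.prod volume) volume := by
    have h := (measurePreserving_piEquivPiSubtypeProd
      (fun _ : Fin s => (volume : Measure ℝ)) (· ∈ u)).symm
    have hinst : (Subtype.fintype (· ∈ u) : Fintype {j // j ∈ u}) = Finset.Subtype.fintype u :=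
      Subsingleton.elim _ _
    rw [hinst] at h
    exact h
  have hsymm : ∀ p, e.symm p = glue u p.1 p.2 := fun p => rfl
  have hpre : e.symm ⁻¹' unitCube (Fin s) = unitCube {j // j ∈ u} ×ˢ unitCube {j // j ∉ u} := by
    ext ⟨y, z⟩
    rw [Set.mem_preimage, hsymm, Set.mem_prod]
    refine ⟨fun h => ⟨mem_unitCube.2 fun j => ?_, mem_unitCube.2 fun j => ?_⟩,
      fun h => glue_mem_unitCube h.1 h.2⟩
    · have := mem_unitCube.1 h j
      rwa [glue_mem] at this
    · have := mem_unitCube.1 h j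
      rwa [glue_notMem] at this
  have hint := integrableOn_mul_prod hg hφ
  have hint' := (hmp.integrableOn_comp_preimage e.symm.measurableEmbedding).2 hint
  rw [hpre] at hint'
  rw [← hmp.setIntegral_preimage_emb e.symm.measurableEmbedding, hpre, setIntegral_prod]
  · refine setIntegral_congr_fun (measurableSet_unitCube _) fun y _ => ?_
    simp only [partialInt, hsymm]
    rw [← integral_mul_const]
    refine setIntegral_congr_fun (measurableSet_unitCube _) fun z _ => ?_
    rw [← prod_mem_mul_prod_notMem u fun j => φ j (glue u y z j)]
    simp only [glue_mem, glue_notMem]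
    ring
  · exact hint'

lemma walL_sort (S : Finset ℕ) (x : ℝ) : walL (S.sort (fun a b => b ≤ a)) x = walS S x := by
  unfold walL walS Finset.prod
  conv_rhs => rw [← Finset.sort_eq S (fun a b => b ≤ a)]
  rw [Multiset.map_coe, Multiset.prod_coe]

lemma prod_map_sort_reverse (S : Finset ℕ) (g : ℕ → ℝ) :
    ((S.sort (fun a b => b ≤ a)).reverse.map g).prod = ∏ a ∈ S, g a := by
  rw [List.map_reverse, List.prod_reverse]
  unfold Finset.prod
  conv_rhs => rw [← Finset.sort_eq S (fun a b => b ≤ a)]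
  rw [Multiset.map_coe, Multiset.prod_coe]

lemma pairwise_sort_reverse (S : Finset ℕ) :
    (S.sort (fun a b => b ≤ a)).reverse.Pairwise (· < ·) := by
  rw [List.pairwise_reverse]
  exact (Finset.sortedGT_sort S).pairwise

/-- The iterated primitive of the Walsh function of `S`. -/
def triF (S : Finset ℕ) : ℝ → ℝ := triW (S.sort (fun a b => b ≤ a)).reverse

lemma continuous_triF (S : Finset ℕ) : Continuous (triF S) := continuous_triW _

lemma triF_nonneg (S : Finset ℕ) (x : ℝ) : 0 ≤ triF S x :=
  (triW_nonneg_and_le (pairwise_sort_reverse S) x).1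

lemma triF_le (S : Finset ℕ) (x : ℝ) : triF S x ≤ ∏ a ∈ S, ((2 : ℝ) ^ a)⁻¹ := by
  rw [← prod_map_sort_reverse]
  exact (triW_nonneg_and_le (pairwise_sort_reverse S) x).2

lemma triF_periodic {S : Finset ℕ} {b : ℕ} (hb : ∀ a ∈ S, b < a) :
    Function.Periodic (triF S) ((2 : ℝ) ^ b)⁻¹ :=
  (triW_periodic_and_mean (pairwise_sort_reverse S)).1 b fun c hc => hb c (by simpa using hc)

lemma iterate_prim_walS {S R : Finset ℕ} (hSR : ∀ a ∈ S, ∀ r ∈ R, r < a) (hS : ∀ a ∈ S, 1 ≤ a) :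
    Set.EqOn (prim^[S.card] fun x => walS S x * walS R x) (fun x => triF S x * walS R x)
      (Set.Icc 0 1) ∧
    ∀ m, 1 ≤ m → m ≤ S.card → prim^[m] (fun x => walS S x * walS R x) 1 = 0 := by
  have := iterate_prim_walsh (S.sort (fun a b => b ≤ a)) [] R (fun x => walS S x * walS R x)
    (by simpa using pairwise_sort_reverse S) (fun a ha => hSR a (by simpa using ha))
    (fun a ha => hS a (by simpa using ha)) (fun x _ => by simp [triW, walL_sort])
  simpa [triF] using this

/-! ### Block estimates -/

/-- The variables in which the block with parameter `l` has a prescribed nonzero digit. -/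
def activeVars {s : ℕ} (l : Fin s → ℕ) : Finset (Fin s) := Finset.univ.filter fun j => l j ≠ 0

lemma mem_activeVars {s : ℕ} {l : Fin s → ℕ} {j : Fin s} : j ∈ activeVars l ↔ l j ≠ 0 := by
  simp [activeVars]

/-- The digit positions of an index whose digits above `l` are `t` and whose digits below `l` are
`S`; the digit at `l` itself is present unless `l = 0`. -/
def assemble (l : ℕ) (t S : Finset ℕ) : Finset ℕ := t ∪ ((if l = 0 then ∅ else {l}) ∪ S)

/-- The contribution of all indices with the same digits `t_j` above `l_j`. -/
lemma sum_sq_fixed_top_le {s α : ℕ} {lam v : ℝ} (hv0 : 0 ≤ v) {f : (Fin s → ℝ) → ℝ}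
    (hf : IsCMixed α f) {l : Fin s → ℕ} {t : Fin s → Finset ℕ} (ht : ∀ j, ∀ a ∈ t j, l j < a)
    (hcard : ∀ j, (t j).card ≤ α)
    (hv : marginalVar lam (activeVars l) (mixedDeriv f fun j => (t j).card) ≤ ENNReal.ofReal v) :
    ∑ S ∈ Fintype.piFinset fun j => (Finset.Ico 1 (l j)).powerset,
      (∫ x in unitCube (Fin s), f x * ∏ j, walS (assemble (l j) (t j) (S j)) (x j)) ^ 2 ≤
      (∏ j, ∏ a ∈ t j, ((2 : ℝ) ^ a)⁻¹) ^ 2 * ((∏ j, ((2 : ℝ) ^ l j)⁻¹) ^ lam) ^ 2 * v ^ 2 := by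
  set u := activeVars l with hu
  set β : Fin s → ℕ := fun j => (t j).card with hβ
  set g := mixedDeriv f β with hg
  have hgc : ContinuousOn g (unitCube (Fin s)) := (hf β hcard).1
  set C : Fin s → ℝ := fun j => ∏ a ∈ t j, ((2 : ℝ) ^ a)⁻¹ with hC
  have hCpos : ∀ j, 0 < C j := fun j => Finset.prod_pos fun a _ => by positivity
  set ρ : {j // j ∉ u} → ℝ → ℝ := fun j x => (C j)⁻¹ * triF (t j) x with hρ
  have hρc : ∀ j, Continuous (ρ j) := fun j => continuous_const.mul (continuous_triF _)
  have hweight : IsWeight u ρ := by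
    refine fun j => ⟨(hρc j).continuousOn, fun x _ => ⟨?_, ?_⟩⟩
    · exact mul_nonneg (inv_nonneg.2 (hCpos j).le) (triF_nonneg _ _)
    · rw [hρ, inv_mul_le_iff₀ (hCpos j), mul_one]
      exact triF_le _ _
  set G := partialInt u (fun x => g x * ∏ j, ρ j (x j.1)) with hG
  have hGv : vitaliVar lam G ≤ ENNReal.ofReal v :=
    le_trans (le_iSup₂ (f := fun (ρ : {j // j ∉ u} → ℝ → ℝ) (_ : IsWeight u ρ) =>
      vitaliVar lam (partialInt u (fun x => g x * ∏ j, ρ j (x j.1)))) ρ hweight) hv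
  have hGc : ContinuousOn G (unitCube _) := by
    refine continuousOn_partialInt u (hgc.mul (Continuous.continuousOn ?_))
    exact continuous_finsetProd _ fun j _ => (hρc j).comp (continuous_apply j.1)
  have hl : ∀ j : {j // j ∈ u}, 1 ≤ l j := fun j => by
    have := mem_activeVars.1 j.2
    omega
  have main := sum_sq_setIntegral_walsh_le hv0 (l := fun j : {j // j ∈ u} => l j) hl hGc hGv
    (W := fun j => triF (t j)) (fun j => continuous_triF _) (fun j => triF_periodic (ht j))
    (c := fun j => C j) fun j x => by
      rw [abs_of_nonneg (triF_nonneg _ _)]; exact triF_le _ _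
  -- Rewriting the coefficients with the help of integration by parts and Fubini's theorem.
  have hterm : ∀ S ∈ Fintype.piFinset fun j => (Finset.Ico 1 (l j)).powerset,
      (∫ x in unitCube (Fin s), f x * ∏ j, walS (assemble (l j) (t j) (S j)) (x j)) ^ 2 =
      (∏ j : {j // j ∉ u}, C j) ^ 2 * (∫ y in unitCube {j // j ∈ u}, G y *
        ∏ j : {j // j ∈ u}, (triF (t j) (y j) * rad (l j) (y j) * walS (S j) (y j))) ^ 2 := by
    intro S hS
    have hSl : ∀ j, ∀ a ∈ S j, 1 ≤ a ∧ a < l j := fun j a ha =>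
      Finset.mem_Ico.1 (Finset.mem_powerset.1 (Fintype.mem_piFinset.1 hS j) ha)
    set R : Fin s → Finset ℕ := fun j => (if l j = 0 then ∅ else {l j}) ∪ S j with hR
    have hRle : ∀ j, ∀ r ∈ R j, r ≤ l j := by
      intro j r hr
      rcases Finset.mem_union.1 hr with h | h
      · split_ifs at h
        · simp at h
        · exact (Finset.mem_singleton.1 h).le
      · exact (hSl j r h).2.le
    have hsplit : ∀ j x, walS (assemble (l j) (t j) (S j)) x = walS (t j) x * walS (R j) x := by
      intro j x
      refine Finset.prod_union (Finset.disjoint_left.2 fun a ha hr => ?_)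
      exact absurd (hRle j a hr) (not_le.2 (ht j a ha))
    have hprim := fun j => iterate_prim_walS (S := t j) (R := R j)
      (fun a ha r hr => (hRle j r hr).trans_lt (ht j a ha)) (fun a ha => by
        have := ht j a ha; omega)
    have hRu : ∀ (j : {j // j ∈ u}) x, walS (R j) x = rad (l j) x * walS (S j) x := by
      intro j x
      have h0 := mem_activeVars.1 j.2
      simp only [hR, if_neg h0]
      unfold walS
      rw [Finset.prod_union, Finset.prod_singleton]
      rw [Finset.disjoint_singleton_left]
      exact fun h => lt_irrefl _ (hSl j _ h).2
    have hRn : ∀ (j : {j // j ∉ u}) x, walS (R j) x = 1 := by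
      intro j x
      have h0 : l j = 0 := by
        by_contra h
        exact j.2 (mem_activeVars.2 h)
      have hempty : R j = ∅ := by
        refine Finset.eq_empty_of_forall_notMem fun a ha => ?_
        simp only [hR, if_pos h0, Finset.empty_union] at ha
        have := hSl j a ha
        omega
      rw [hempty]; simp [walS]
    set Ψ : Fin s → ℝ → ℝ := fun j x => (if j ∈ u then 1 else (C j)⁻¹) * triF (t j) x *
      walS (R j) x with hΨ
    have hΨb : ∀ j, LocBdd (Ψ j) := fun j =>
      (continuous_const.mul (continuous_triF _)).locBdd.mul (locBdd_walS _)
    have e1 := abs_setIntegral_eq_mixedDeriv hf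
      (φ := fun j x => walS (t j) x * walS (R j) x)
      (fun j => (locBdd_walS _).mul (locBdd_walS _)) β hcard fun j m h1 h2 => (hprim j).2 m h1 h2
    have e2 : ∫ x in unitCube (Fin s), mixedDeriv f β x *
        ∏ j, (prim^[β j] fun x => walS (t j) x * walS (R j) x) (x j) =
        (∏ j : {j // j ∉ u}, C j) * ∫ x in unitCube (Fin s), g x * ∏ j, Ψ j (x j) := by
      rw [← integral_const_mul]
      refine setIntegral_congr_fun (measurableSet_unitCube _) fun x hx => ?_
      have h1 : ∏ j, (prim^[β j] fun x => walS (t j) x * walS (R j) x) (x j) =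
          ∏ j, (if j ∈ u then 1 else C j) * Ψ j (x j) := by
        refine Finset.prod_congr rfl fun j _ => ?_
        rw [(hprim j).1 (mem_unitCube.1 hx j)]
        simp only [hΨ]
        split_ifs
        · ring
        · have := (hCpos j).ne'
          field_simp
      have h2 : ∏ j, (if j ∈ u then (1 : ℝ) else C j) = ∏ j : {j // j ∉ u}, C j := by
        rw [← prod_mem_mul_prod_notMem u]
        rw [Finset.prod_eq_one fun (j : {j // j ∈ u}) _ => if_pos j.2, one_mul]
        exact Finset.prod_congr rfl fun j _ => if_neg j.2
      rw [h1, Finset.prod_mul_distrib, h2]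
      ring
    have e3 := setIntegral_unitCube_eq_partialInt u hgc hΨb
    have e4 : ∀ x : Fin s → ℝ, ∏ j : {j // j ∉ u}, Ψ j (x j) = ∏ j, ρ j (x j.1) := fun x =>
      Finset.prod_congr rfl fun j _ => by simp only [hΨ, hρ, if_neg j.2, hRn j, mul_one]
    have e5 : ∀ y : {j // j ∈ u} → ℝ, ∏ j : {j // j ∈ u}, Ψ j (y j) =
        ∏ j : {j // j ∈ u}, (triF (t j) (y j) * rad (l j) (y j) * walS (S j) (y j)) := fun y =>
      Finset.prod_congr rfl fun j _ => by simp only [hΨ, if_pos j.2, hRu j, one_mul, mul_assoc]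
    simp only [e4, e5] at e3
    simp only [hsplit]
    rw [← sq_abs, e1, sq_abs, e2, e3, mul_pow]
  rw [Finset.sum_congr rfl hterm, ← Finset.mul_sum]
  -- The factors of the index set are trivial outside `u`.
  have hrestrict : ∑ S ∈ Fintype.piFinset fun j => (Finset.Ico 1 (l j)).powerset,
      (∫ y in unitCube {j // j ∈ u}, G y *
        ∏ j : {j // j ∈ u}, (triF (t j) (y j) * rad (l j) (y j) * walS (S j) (y j))) ^ 2 ≤
      ∑ S ∈ Fintype.piFinset fun j : {j // j ∈ u} => (Finset.Ico 1 (l j)).powerset,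
      (∫ y in unitCube {j // j ∈ u}, G y *
        ∏ j : {j // j ∈ u}, (triF (t j) (y j) * rad (l j) (y j) * walS (S j) (y j))) ^ 2 := by
    set res : (Fin s → Finset ℕ) → ({j // j ∈ u} → Finset ℕ) := fun S j => S j with hres
    set Λ := Fintype.piFinset fun j => (Finset.Ico 1 (l j)).powerset with hΛ
    have hinj : Set.InjOn res (Λ : Set (Fin s → Finset ℕ)) := by
      intro S hS S' hS' h
      funext j
      by_cases hj : j ∈ u
      · exact congrFun h ⟨j, hj⟩
      · have h0 : l j = 0 := by
          by_contra hc
          exact hj (mem_activeVars.2 hc)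
        have h1 := Fintype.mem_piFinset.1 hS j
        have h2 := Fintype.mem_piFinset.1 hS' j
        rw [h0] at h1 h2
        simp at h1 h2
        rw [h1, h2]
    rw [← Finset.sum_image (s := Λ) (g := res) (f := fun S => (∫ y in unitCube {j // j ∈ u}, G y *
        ∏ j : {j // j ∈ u}, (triF (t j) (y j) * rad (l j) (y j) * walS (S j) (y j))) ^ 2) hinj]
    refine Finset.sum_le_sum_of_subset_of_nonneg ?_ fun _ _ _ => sq_nonneg _
    intro S hS
    obtain ⟨S', hS', rfl⟩ := Finset.mem_image.1 hS
    exact Fintype.mem_piFinset.2 fun j => Fintype.mem_piFinset.1 hS' j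
  have hprodC : (∏ j : {j // j ∈ u}, C j) * ∏ j : {j // j ∉ u}, C j = ∏ j, C j :=
    prod_mem_mul_prod_notMem u C
  have hprodl : ∏ j : {j // j ∈ u}, ((2 : ℝ) ^ l j)⁻¹ = ∏ j, ((2 : ℝ) ^ l j)⁻¹ := by
    rw [← prod_mem_mul_prod_notMem u fun j => ((2 : ℝ) ^ l j)⁻¹]
    have h1 : ∏ j : {j // j ∉ u}, ((2 : ℝ) ^ l j)⁻¹ = 1 := by
      refine Finset.prod_eq_one fun j _ => ?_
      have h0 : l j = 0 := by
        by_contra h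
        exact j.2 (mem_activeVars.2 h)
      simp [h0]
    rw [h1, mul_one]
  calc _ ≤ (∏ j : {j // j ∉ u}, C j) ^ 2 * ((∏ j : {j // j ∈ u}, C j) ^ 2 *
        ((∏ j : {j // j ∈ u}, ((2 : ℝ) ^ l j)⁻¹) ^ lam) ^ 2 * v ^ 2) :=
        mul_le_mul_of_nonneg_left (hrestrict.trans main) (sq_nonneg _)
    _ = _ := by rw [hprodl, ← hprodC]; ring

/-! ### Digits of the indices in a block -/

/-- The digits of an index whose `(α+1)`-st largest digit is `l`: at most `α` of them lie above `l`,
and exactly `α` if `l` is not the default value `0`. -/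
lemma block_digits {κ : Finset ℕ} {α l : ℕ} (h : nthLargest κ (α + 1) = l) :
    (κ.filter (l < ·)).card ≤ α ∧ (l ≠ 0 → l ∈ κ ∧ (κ.filter (l < ·)).card = α) := by
  set L := κ.sort (fun a b => b ≤ a) with hL
  have hpw : L.Pairwise (· > ·) := (Finset.sortedGT_sort κ).pairwise
  have hnd : L.Nodup := Finset.sort_nodup κ _
  have hmem : ∀ a, a ∈ L ↔ a ∈ κ := fun a => by simp [hL]
  have hlen : L.length = κ.card := by simp [hL]
  have hget : L.getD α 0 = l := h
  rcases Nat.lt_or_ge α L.length with hα | hα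
  · rw [List.getD_eq_getElem _ _ hα] at hget
    have hdec : L = L.take α ++ l :: L.drop (α + 1) := by
      conv_lhs => rw [← List.take_append_drop α L, List.drop_eq_getElem_cons hα, hget]
    have hcard : (κ.filter (l < ·)).card = α := by
      have h1 : κ.filter (l < ·) = (L.filter fun a => decide (l < a)).toFinset := by
        ext a; simp [hmem]
      rw [h1, List.toFinset_card_of_nodup (hnd.filter _), hdec,
        List.filter_append]
      rw [hdec, List.pairwise_append, List.pairwise_cons] at hpw
      rw [List.filter_eq_self.2, List.filter_eq_nil_iff.2]
      · simp [hα.le]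
      · intro a ha
        rcases List.mem_cons.1 ha with rfl | ha
        · simp
        · simpa using (hpw.2.1.1 a ha).le
      · intro a ha
        simpa using hpw.2.2 a ha l (by simp)
    refine ⟨hcard.le, fun _ => ⟨?_, hcard⟩⟩
    rw [← hmem, ← hget]
    exact List.getElem_mem hα
  · rw [List.getD_eq_default _ _ hα] at hget
    refine ⟨(Finset.card_filter_le _ _).trans (hlen ▸ hα), fun h0 => absurd hget.symm h0⟩

lemma assemble_filter {κ : Finset ℕ} (hκ : ∀ a ∈ κ, 1 ≤ a) {l : ℕ} (hl : l ≠ 0 → l ∈ κ) :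
    assemble l (κ.filter (l < ·)) (κ.filter (· < l)) = κ := by
  ext a
  unfold assemble
  by_cases h0 : l = 0
  · subst h0
    simp only [if_true, Finset.mem_union, Finset.mem_filter, Finset.notMem_empty]
    constructor
    · tauto
    · intro h; exact Or.inl ⟨h, hκ a h⟩
  · simp only [if_neg h0, Finset.mem_union, Finset.mem_filter, Finset.mem_singleton]
    constructor
    · rintro (h | rfl | h)
      · exact h.1
      · exact hl h0
      · exact h.1
    · intro h
      rcases lt_trichotomy a l with h1 | h1 | h1
      · exact Or.inr (Or.inr ⟨h, h1⟩)
      · exact Or.inr (Or.inl h1)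
      · exact Or.inl ⟨h, h1⟩

lemma walshCoeff_eq {s : ℕ} (f : (Fin s → ℝ) → ℝ) (k : Fin s → ℕ) :
    walshCoeff f k = ∫ x in unitCube (Fin s), f x * ∏ j, walS (bitSet (k j)) (x j) := by
  refine setIntegral_congr_fun (measurableSet_unitCube _) fun x hx => ?_
  simp only [wal]
  congr 1
  exact Finset.prod_congr rfl fun j _ => wal₁_eq_walS _ (mem_unitCube.1 hx j).1

/-! ### Summation over the block -/

/-- The elementary symmetric functions are at most the powers of the sum. -/
lemma sum_powersetCard_prod_le (A : Finset ℕ) {w : ℕ → ℝ} (hw : ∀ a, 0 ≤ w a) (n : ℕ) :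
    ∑ t ∈ A.powersetCard n, ∏ a ∈ t, w a ≤ (∑ a ∈ A, w a) ^ n := by
  induction A using Finset.induction_on generalizing n with
  | empty =>
    cases n with
    | zero => simp
    | succ n => rw [Finset.powersetCard_eq_empty.2 (by simp)]; simp
  | insert b A hb ih =>
    cases n with
    | zero => simp
    | succ n =>
      have hS : 0 ≤ ∑ a ∈ A, w a := Finset.sum_nonneg fun a _ => hw a
      rw [Finset.powersetCard_succ_insert hb, Finset.sum_union, Finset.sum_image,
        Finset.sum_insert hb]
      · have h1 : ∀ t ∈ A.powersetCard n, ∏ a ∈ insert b t, w a = w b * ∏ a ∈ t, w a :=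
          fun t ht => Finset.prod_insert fun h => hb ((Finset.mem_powersetCard.1 ht).1 h)
        rw [Finset.sum_congr rfl h1, ← Finset.mul_sum]
        calc _ ≤ (∑ a ∈ A, w a) ^ (n + 1) + w b * (∑ a ∈ A, w a) ^ n :=
              add_le_add (ih _) (mul_le_mul_of_nonneg_left (ih n) (hw b))
          _ = (w b + ∑ a ∈ A, w a) * (∑ a ∈ A, w a) ^ n := by ring
          _ ≤ (w b + ∑ a ∈ A, w a) * (w b + ∑ a ∈ A, w a) ^ n := by
              have := hw b
              gcongr
              linarith
          _ = _ := by ring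
      · intro t ht t' ht' h
        have hn : b ∉ t := fun h => hb ((Finset.mem_powersetCard.1 ht).1 h)
        have hn' : b ∉ t' := fun h => hb ((Finset.mem_powersetCard.1 ht').1 h)
        rw [← Finset.erase_insert hn, ← Finset.erase_insert hn', h]
      · rw [Finset.disjoint_left]
        intro t ht ht'
        obtain ⟨t', _, rfl⟩ := Finset.mem_image.1 ht'
        exact hb ((Finset.mem_powersetCard.1 ht).1 (Finset.mem_insert_self _ _))

lemma sum_Ioc_four_pow_inv_le (l M : ℕ) :
    ∑ a ∈ Finset.Ioc l M, ((4 : ℝ) ^ a)⁻¹ ≤ ((4 : ℝ) ^ l)⁻¹ := by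
  rcases Nat.lt_or_ge M l with h | h
  · rw [Finset.Ioc_eq_empty (by omega), Finset.sum_empty]; positivity
  · have key : ∑ a ∈ Finset.Ioc l M, ((4 : ℝ) ^ a)⁻¹ ≤ ((4 : ℝ) ^ l)⁻¹ - ((4 : ℝ) ^ M)⁻¹ := by
      induction M, h using Nat.le_induction with
      | base => simp
      | succ M hM ih =>
        rw [Finset.sum_Ioc_succ_top (by omega)]
        have h1 : ((4 : ℝ) ^ M)⁻¹ = 4 * ((4 : ℝ) ^ (M + 1))⁻¹ := by rw [pow_succ]; field_simp
        have h2 : (0 : ℝ) ≤ ((4 : ℝ) ^ (M + 1))⁻¹ := by positivity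
        linarith
    have : (0 : ℝ) ≤ ((4 : ℝ) ^ M)⁻¹ := by positivity
    linarith

/-- Summation over the digits above `l_j`, when their numbers `β_j` are prescribed. -/
lemma sum_top_le {s : ℕ} (l β : Fin s → ℕ) (M : ℕ) :
    ∑ t ∈ Fintype.piFinset fun j => (Finset.Ioc (l j) M).powersetCard (β j),
      (∏ j, ∏ a ∈ t j, ((2 : ℝ) ^ a)⁻¹) ^ 2 ≤ ∏ j, (((4 : ℝ) ^ l j)⁻¹) ^ β j := by
  have h1 : ∀ t : Fin s → Finset ℕ, (∏ j, ∏ a ∈ t j, ((2 : ℝ) ^ a)⁻¹) ^ 2 =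
      ∏ j, ∏ a ∈ t j, ((4 : ℝ) ^ a)⁻¹ := by
    intro t
    simp only [← Finset.prod_pow]
    refine Finset.prod_congr rfl fun j _ => Finset.prod_congr rfl fun a _ => ?_
    rw [inv_pow, ← pow_mul, mul_comm, pow_mul]; norm_num
  have h2 := Finset.prod_univ_sum (fun j => (Finset.Ioc (l j) M).powersetCard (β j))
    fun _ t => ∏ a ∈ t, ((4 : ℝ) ^ a)⁻¹
  simp only [h1]
  rw [← h2]
  refine Finset.prod_le_prod
    (fun j _ => Finset.sum_nonneg fun t _ => Finset.prod_nonneg fun a _ => by positivity)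
    fun j _ => ?_
  refine (sum_powersetCard_prod_le _ (fun a => by positivity) _).trans ?_
  exact pow_le_pow_left₀ (Finset.sum_nonneg fun a _ => by positivity)
    (sum_Ioc_four_pow_inv_le _ _) _

lemma marginalVar_ne_top_and_sum_le {s α : ℕ} {lam : ℝ} {f : (Fin s → ℝ) → ℝ}
    (hN : fracNorm α lam f < ⊤) {u : Finset (Fin s)} (hu : u.Nonempty) :
    (∀ β ∈ Fintype.piFinset (fun _ : Fin s => Finset.range (α + 1)),
      marginalVar lam u (mixedDeriv f β) ≠ ⊤) ∧
    ∑ β ∈ Fintype.piFinset (fun _ : Fin s => Finset.range (α + 1)),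
      (marginalVar lam u (mixedDeriv f β)).toReal ^ 2 ≤ (fracNorm α lam f).toReal ^ 2 := by
  have h1 : (∑ β ∈ Fintype.piFinset (fun _ : Fin s => Finset.range (α + 1)),
      marginalVar lam u (mixedDeriv f β) ^ 2) ^ (1 / 2 : ℝ) ≤ fracNorm α lam f :=
    le_iSup₂ (f := fun (u : Finset (Fin s)) (_ : u.Nonempty) =>
      (∑ β ∈ Fintype.piFinset (fun _ : Fin s => Finset.range (α + 1)),
        marginalVar lam u (mixedDeriv f β) ^ 2) ^ (1 / 2 : ℝ)) u hu
  rw [one_div, ENNReal.rpow_inv_le_iff (by norm_num), ENNReal.rpow_ofNat] at h1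
  have hfin : fracNorm α lam f ^ 2 ≠ ⊤ := ENNReal.pow_ne_top hN.ne
  have hne : ∀ β ∈ Fintype.piFinset (fun _ : Fin s => Finset.range (α + 1)),
      marginalVar lam u (mixedDeriv f β) ^ 2 ≠ ⊤ := fun β hβ =>
    ne_top_of_le_ne_top hfin ((Finset.single_le_sum (f := fun β =>
      marginalVar lam u (mixedDeriv f β) ^ 2) (fun _ _ => zero_le) hβ).trans h1)
  refine ⟨fun β hβ h => hne β hβ (by rw [h]; simp), ?_⟩
  have h2 := ENNReal.toReal_mono hfin h1
  rw [ENNReal.toReal_sum hne, ENNReal.toReal_pow] at h2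
  simpa only [ENNReal.toReal_pow] using h2

/-- The estimate for finite partial sums over a block. -/
lemma sum_sq_walshCoeff_le {s α : ℕ} {lam : ℝ} {f : (Fin s → ℝ) → ℝ} (hf : IsCMixed α f)
    (hN : fracNorm α lam f < ⊤) {l : Fin s → ℕ} (hl : l ≠ 0) (K : Finset (block α l)) :
    ∑ k ∈ K, |walshCoeff f k| ^ 2 ≤
      ((∏ j, ((2 : ℝ) ^ l j)⁻¹) ^ lam) ^ 2 * (∏ j, ((4 : ℝ) ^ l j)⁻¹) ^ α *
        (fracNorm α lam f).toReal ^ 2 := by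
  have hu : (activeVars l).Nonempty := by
    obtain ⟨j, hj⟩ := Function.ne_iff.1 hl
    exact ⟨j, mem_activeVars.2 hj⟩
  obtain ⟨hfin, hsum⟩ := marginalVar_ne_top_and_sum_le hN hu
  set v : (Fin s → ℕ) → ℝ := fun β => (marginalVar lam (activeVars l) (mixedDeriv f β)).toReal
    with hv
  set D := ((∏ j, ((2 : ℝ) ^ l j)⁻¹) ^ lam) ^ 2 with hD
  set c : (Fin s → Finset ℕ) → ℝ := fun t => (∏ j, ∏ a ∈ t j, ((2 : ℝ) ^ a)⁻¹) ^ 2 with hc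
  set Λ := Fintype.piFinset fun j => (Finset.Ico 1 (l j)).powerset with hΛ
  set Bs := Fintype.piFinset (fun _ : Fin s => Finset.range (α + 1)) with hBs
  -- A bound for all digit positions that occur in the finite set `K`.
  obtain ⟨M, hM⟩ : ∃ M, ∀ k ∈ K, ∀ j, ∀ a ∈ bitSet (k.1 j), a ≤ M := by
    refine ⟨K.sup fun k => Finset.univ.sup fun j => (bitSet (k.1 j)).sup id,
      fun k hk j a ha => ?_⟩
    calc a ≤ (bitSet (k.1 j)).sup id := Finset.le_sup (f := id) ha
      _ ≤ Finset.univ.sup fun j => (bitSet (k.1 j)).sup id :=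
        Finset.le_sup (f := fun j => (bitSet (k.1 j)).sup id) (Finset.mem_univ j)
      _ ≤ _ := Finset.le_sup (f := fun k : block α l =>
        Finset.univ.sup fun j => (bitSet (k.1 j)).sup id) hk
  set Ts := Fintype.piFinset fun j => (Finset.Ioc (l j) M).powerset.filter
    fun t => t.card ≤ α ∧ (l j ≠ 0 → t.card = α) with hTs
  set E : (Fin s → Finset ℕ) × (Fin s → Finset ℕ) → ℝ := fun p =>
    (∫ x in unitCube (Fin s), f x * ∏ j, walS (assemble (l j) (p.1 j) (p.2 j)) (x j)) ^ 2 with hE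
  set Φ : block α l → (Fin s → Finset ℕ) × (Fin s → Finset ℕ) := fun k =>
    (fun j => (bitSet (k.1 j)).filter (l j < ·), fun j => (bitSet (k.1 j)).filter (· < l j))
    with hΦ
  have hdig : ∀ (k : block α l) j, ((bitSet (k.1 j)).filter (l j < ·)).card ≤ α ∧
      (l j ≠ 0 → l j ∈ bitSet (k.1 j) ∧ ((bitSet (k.1 j)).filter (l j < ·)).card = α) :=
    fun k j => block_digits (k.2.2 j)
  have hass : ∀ (k : block α l) j, assemble (l j) ((Φ k).1 j) ((Φ k).2 j) = bitSet (k.1 j) :=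
    fun k j => assemble_filter (fun a ha => one_le_of_mem_bitSet ha) fun h => ((hdig k j).2 h).1
  have hΦinj : Function.Injective Φ := by
    intro k k' h
    apply Subtype.ext
    funext j
    apply bitSet_injective
    rw [← hass k j, ← hass k' j, h]
  have hterm : ∀ k ∈ K, |walshCoeff f k| ^ 2 = E (Φ k) := by
    intro k _
    simp only [hE, hass]
    rw [sq_abs, walshCoeff_eq]
  have hmaps : K.image Φ ⊆ Ts ×ˢ Λ := by
    intro p hp
    obtain ⟨k, hk, rfl⟩ := Finset.mem_image.1 hp
    rw [Finset.mem_product, Fintype.mem_piFinset, Fintype.mem_piFinset]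
    refine ⟨fun j => ?_, fun j => ?_⟩
    · rw [Finset.mem_filter, Finset.mem_powerset]
      refine ⟨fun a ha => ?_, (hdig k j).1, fun h => ((hdig k j).2 h).2⟩
      have := Finset.mem_filter.1 ha
      exact Finset.mem_Ioc.2 ⟨this.2, hM k hk j a this.1⟩
    · rw [Finset.mem_powerset]
      intro a ha
      have := Finset.mem_filter.1 ha
      exact Finset.mem_Ico.2 ⟨one_le_of_mem_bitSet this.1, this.2⟩
  have hcardmem : ∀ t ∈ Ts, (fun j => (t j).card) ∈ Bs := by
    intro t ht
    refine Fintype.mem_piFinset.2 fun j => Finset.mem_range.2 ?_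
    have := (Finset.mem_filter.1 (Fintype.mem_piFinset.1 ht j)).2.1
    omega
  have hblock : ∀ t ∈ Ts, ∑ S ∈ Λ, E (t, S) ≤ c t * D * v (fun j => (t j).card) ^ 2 := by
    intro t ht
    have ht' := Fintype.mem_piFinset.1 ht
    have h1 : ∀ j, t j ∈ (Finset.Ioc (l j) M).powerset ∧ (t j).card ≤ α ∧
        (l j ≠ 0 → (t j).card = α) := fun j =>
      Finset.mem_filter.1 (ht' j)
    refine sum_sq_fixed_top_le ENNReal.toReal_nonneg hf
      (fun j a ha => (Finset.mem_Ioc.1 (Finset.mem_powerset.1 (h1 j).1 ha)).1)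
      (fun j => (h1 j).2.1) ?_
    rw [ENNReal.ofReal_toReal (hfin _ (hcardmem t ht))]
  -- The digits above `l_j` are sorted by their numbers.
  have hfiber : ∀ β ∈ Bs, ∑ t ∈ Ts.filter (fun t => (fun j => (t j).card) = β), c t ≤
      (∏ j, ((4 : ℝ) ^ l j)⁻¹) ^ α := by
    intro β _
    by_cases hβ : ∀ j, l j ≠ 0 → β j = α
    · have hsub : Ts.filter (fun t => (fun j => (t j).card) = β) ⊆
          Fintype.piFinset fun j => (Finset.Ioc (l j) M).powersetCard (β j) := by
        intro t ht
        obtain ⟨htT, rfl⟩ := Finset.mem_filter.1 ht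
        have ht' := Fintype.mem_piFinset.1 htT
        exact Fintype.mem_piFinset.2 fun j => Finset.mem_powersetCard.2
          ⟨Finset.mem_powerset.1 (Finset.mem_filter.1 (ht' j)).1, rfl⟩
      refine (Finset.sum_le_sum_of_subset_of_nonneg hsub fun _ _ _ => sq_nonneg _).trans
        ((sum_top_le l β M).trans_eq ?_)
      rw [← Finset.prod_pow]
      refine Finset.prod_congr rfl fun j _ => ?_
      by_cases h0 : l j = 0
      · simp [h0]
      · rw [hβ j h0]
    · have hempty : Ts.filter (fun t => (fun j => (t j).card) = β) = ∅ := by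
        refine Finset.filter_eq_empty_iff.2 fun t ht h => hβ fun j hj => ?_
        rw [← h]
        exact (Finset.mem_filter.1 (Fintype.mem_piFinset.1 ht j)).2.2 hj
      rw [hempty, Finset.sum_empty]
      positivity
  calc ∑ k ∈ K, |walshCoeff f k| ^ 2 = ∑ p ∈ K.image Φ, E p := by
        rw [Finset.sum_image hΦinj.injOn, Finset.sum_congr rfl hterm]
    _ ≤ ∑ p ∈ Ts ×ˢ Λ, E p :=
        Finset.sum_le_sum_of_subset_of_nonneg hmaps fun _ _ _ => sq_nonneg _
    _ = ∑ t ∈ Ts, ∑ S ∈ Λ, E (t, S) := Finset.sum_product _ _ _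
    _ ≤ ∑ t ∈ Ts, c t * D * v (fun j => (t j).card) ^ 2 := Finset.sum_le_sum hblock
    _ = ∑ β ∈ Bs, ∑ t ∈ Ts.filter (fun t => (fun j => (t j).card) = β),
          c t * D * v (fun j => (t j).card) ^ 2 :=
        (Finset.sum_fiberwise_of_maps_to hcardmem _).symm
    _ = ∑ β ∈ Bs, (∑ t ∈ Ts.filter (fun t => (fun j => (t j).card) = β), c t) *
          (D * v β ^ 2) := by
        refine Finset.sum_congr rfl fun β _ => ?_
        rw [Finset.sum_mul]
        refine Finset.sum_congr rfl fun t ht => ?_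
        rw [(Finset.mem_filter.1 ht).2, mul_assoc]
    _ ≤ ∑ β ∈ Bs, (∏ j, ((4 : ℝ) ^ l j)⁻¹) ^ α * (D * v β ^ 2) :=
        Finset.sum_le_sum fun β hβ => mul_le_mul_of_nonneg_right (hfiber β hβ) (by positivity)
    _ = D * (∏ j, ((4 : ℝ) ^ l j)⁻¹) ^ α * ∑ β ∈ Bs, v β ^ 2 := by
        rw [Finset.mul_sum]
        exact Finset.sum_congr rfl fun β _ => by ring
    _ ≤ _ := mul_le_mul_of_nonneg_left hsum (by positivity)

end FracWalsh

end

theorem mainTheorem6 (s α : ℕ) (lam : ℝ) (hlam : 0 < lam) (hlam1 : lam ≤ 1)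
    (f : (Fin s → ℝ) → ℝ) (hf : FracWalsh.IsCMixed α f)
    (hN : FracWalsh.fracNorm α lam f < ⊤)
    (l : Fin s → ℕ) (hl : l ≠ 0) :
    Summable (fun k : FracWalsh.block α l => |FracWalsh.walshCoeff f k| ^ 2) ∧
    Real.sqrt (∑' k : FracWalsh.block α l, |FracWalsh.walshCoeff f k| ^ 2) ≤
      (FracWalsh.fracNorm α lam f).toReal *
        (2 : ℝ) ^ (-((α : ℝ) + lam) * ((∑ j, l j : ℕ) : ℝ)) := by
  have hfinite := FracWalsh.sum_sq_walshCoeff_le hf hN hl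
  refine ⟨summable_of_sum_le (fun _ => by positivity) hfinite, Real.sqrt_le_iff.2
    ⟨by positivity, (Real.tsum_le_of_sum_le (fun _ => by positivity) hfinite).trans_eq ?_⟩⟩
  have hQ : ∏ j, ((2 : ℝ) ^ l j)⁻¹ = (2 : ℝ) ^ (-((∑ j, l j : ℕ) : ℝ)) := by
    rw [Finset.prod_inv_distrib, Finset.prod_pow_eq_pow_sum, Real.rpow_neg (by norm_num),
      Real.rpow_natCast]
  have hQ4 : ∏ j, ((4 : ℝ) ^ l j)⁻¹ = (∏ j, ((2 : ℝ) ^ l j)⁻¹) ^ 2 := by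
    rw [← Finset.prod_pow]
    refine Finset.prod_congr rfl fun j _ => ?_
    rw [inv_pow, ← pow_mul, mul_comm, pow_mul]; norm_num
  rw [hQ4, hQ, ← pow_mul, mul_comm 2 α, pow_mul, ← mul_pow, ← mul_pow, ← Real.rpow_natCast _ α,
    ← Real.rpow_mul (by norm_num), ← Real.rpow_mul (by norm_num), ← Real.rpow_add (by norm_num)]
  congr 1
  rw [mul_comm]
  congr 2
  ring
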